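/- Let $\lambda:\mathbb{Z}_+\to(0,\infty)$ satisfy $0<\inf_x\lambda(x)\le\sup_x\lambda(x)<\infty$, and let $N\ge 1$. Put $\mathbb{W}^n=\{x\in\mathbb{Z}_+^n: x_1<\dots<x_n\}$; write $y\prec x$ for $y\in\mathbb{W}^n$, $x\in\mathbb{W}^{n+1}$ with $x_1\le y_1<x_2\le\dots\le y_n<x_{n+1}$; and let $\mathsf{GT}_N$ be the set of patterns $(x^1,\dots,x^N)$ with $x^k\in\mathbb{W}^k$ and $x^k\prec x^{k+1}$ for $1\le k<N$. *Dynamics.* The push-block dynamics is the continuous-time Markov chain on $\mathsf{GT}_N$ in which each particle $x^n_k$ carries an independent exponential clock of rate $\lambda(x^n_k)$. When it rings, nothing happens if $k<n$ and $x^{n-1}_k=x^n_k$ (blocking); otherwise $x^n_k$ increases by one and, if $x^n_k<x^{n+1}_{k+1}$ no longer holds, $x^{n+1}_{k+1}$ also increases by one, this pushing being propagated to higher levels as long as needed. Thus its transition function is $e^{tG}$, where $Gf(x)=\sum_{p}\lambda(x_p)\,[f(x^{(p)})-f(x)]$, the sum is over all particles $p$, $x_p$ is the position of $p$, and $x^{(p)}$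 is the pattern after the clock of $p$ has rung. *Kernels.* Let $e^{t\mathsf{L}}(x,y)$ be the transition function of the pure-birth chain on $\mathbb{Z}_+$ with generator $\mathsf{L}f(x)=\lambda(x)(f(x+1)-f(x))$. Define $\mathfrak{h}_1\equiv 1$ and, for $n\ge1$, $x\in\mathbb{W}^{n+1}$, $\mathfrak{h}_{n+1}(x)=\sum_{y\prec x}\mathfrak{h}_n(y)\prod_{i=1}^n\lambda(y_i)^{-1}$. Let $$\mathfrak{L}^{n+1}_{n}(x,y)=\frac{\mathfrak{h}_n(y)}{\mathfrak{h}_{n+1}(x)}\prod_{i=1}^n\frac1{\lambda(y_i)}\mathbf{1}(y\prec x),\qquad \mathfrak{P}^n_t(x,y)=\frac{\mathfrak{h}_n(y)}{\mathfrak{h}_n(x)}\det\big(e^{t\mathsf{L}}(x_i,y_j)\big)_{i,j=1}^n .$$ *Statement.* Let $\mathfrak{M}^N$ be a probability measure on $\mathbb{W}^N$ and let $(\mathsf{X}^1(t),\dots,\mathsf{X}^N(t))_{t\ge0}$ be the push-block dynamics started from the Gibbs measure on $\mathsf{GT}_N$ with density $$\mathsf{M}_N(x^1,\dots,x^N)=\mathfrak{M}^N(x^N)\,\mathfrak{L}^N_{N-1}(x^N,x^{N-1})\cdots\mathfrak{L}^2_1(x^2,x^1).$$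 Then: 1. for every $1\le k\le N$, $(\mathfrak{P}^k_t)_{t\ge0}$ is a semigroup of Markov kernels on $\mathbb{W}^k$ and the projection $(\mathsf{X}^k(t))_{t\ge0}$ on the $k$-th level is a Markov process (in its own filtration) with semigroup $(\mathfrak{P}^k_t)_{t\ge0}$; 2. for every fixed $T\ge0$ and $(x^1,\dots,x^N)\in\mathsf{GT}_N$, $$\mathbb{P}\big(\mathsf{X}^1(T)=x^1,\dots,\mathsf{X}^N(T)=x^N\big)=\big[\mathfrak{M}^N\mathfrak{P}^N_T\big](x^N)\,\mathfrak{L}^N_{N-1}(x^N,x^{N-1})\cdots\mathfrak{L}^2_1(x^2,x^1),$$ where $[\mathfrak{M}^N\mathfrak{P}^N_T](z)=\sum_{w\in\mathbb{W}^N}\mathfrak{M}^N(w)\,\mathfrak{P}^N_T(w,z)$. -/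

import Mathlib

open MeasureTheory
open scoped NNReal

noncomputable section

namespace PushBlock

/-! ### Configurations -/

/-- The discrete Weyl chamber: strictly increasing `n`-tuples of non-negative integers. -/
@[ext]
structure Chamber (n : ℕ) where
  pos : Fin n → ℕ
  strictMono : StrictMono pos

/-- Interlacing `y ≺ x`: `x₁ ≤ y₁ < x₂ ≤ y₂ < ⋯ ≤ yₙ < xₙ₊₁`. -/
def Interlaces {n : ℕ} (y : Chamber n) (x : Chamber (n + 1)) : Prop :=
  ∀ i : Fin n, x.pos i.castSucc ≤ y.pos i ∧ y.pos i < x.pos i.succ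

/-- Gelfand-Tsetlin patterns with `N` levels. The level numbered `k : Fin N` here (counted from
`0`) is the `(k+1)`-st level and carries `k + 1` particles. -/
@[ext]
structure GT (N : ℕ) where
  level : (k : Fin N) → Chamber ((k : ℕ) + 1)
  interlaces : ∀ (k : ℕ) (hk : k + 1 < N),
    Interlaces (level ⟨k, Nat.lt_of_succ_lt hk⟩) (level ⟨k + 1, hk⟩)

instance (n : ℕ) : MeasurableSpace (Chamber n) := ⊤

instance (N : ℕ) : MeasurableSpace (GT N) := ⊤

/-- The labels of the particles: a level together with the index of a particle on that level
(both counted from `0`). -/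
abbrev Particle (N : ℕ) : Type := (k : Fin N) × Fin ((k : ℕ) + 1)

/-- The position of a particle in a pattern. -/
def GT.pos {N : ℕ} (x : GT N) (p : Particle N) : ℕ := (x.level p.1).pos p.2

/-- `q` carries the same index as `p`, one level above `p`. -/
def Particle.SameIndexAbove {N : ℕ} (p q : Particle N) : Prop :=
  (q.1 : ℕ) = p.1 + 1 ∧ (q.2 : ℕ) = p.2

/-- `q` carries the next index after that of `p`, one level above `p`. -/
def Particle.NextIndexAbove {N : ℕ} (p q : Particle N) : Prop :=
  (q.1 : ℕ) = p.1 + 1 ∧ (q.2 : ℕ) = p.2 + 1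

/-! ### The push-block mechanism -/

/-- The particle `p` is blocked: the particle with the same index on the level below has the
same position. -/
def Blocked {N : ℕ} (x : GT N) (p : Particle N) : Prop :=
  ∃ q : Particle N, q.SameIndexAbove p ∧ x.pos q = x.pos p

/-- The particles that move to the right by one when `p` jumps: `p` itself and, recursively, every
particle `q'` which is next-index-above a moving particle `q` and whose strict inequality
`pos q < pos q'` would be broken by the move of `q`. -/
inductive Moves {N : ℕ} (x : GT N) (p : Particle N) : Particle N → Prop
  | self : Moves x p p
  | push (q q' : Particle N) : Moves x p q → q.NextIndexAbove q' → ¬ (x.pos q + 1 < x.pos q') →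
      Moves x p q'

theorem GT.pos_le {N : ℕ} (x : GT N) {q p : Particle N} (h : q.SameIndexAbove p) :
    x.pos p ≤ x.pos q := by
  obtain ⟨⟨k, hk⟩, ⟨i, hi⟩⟩ := q
  obtain ⟨⟨k', hk'⟩, ⟨i', hi'⟩⟩ := p
  obtain ⟨h1, h2⟩ := h
  dsimp at h1 h2
  subst h1 h2
  exact (x.interlaces k hk' ⟨i', hi⟩).1

theorem GT.pos_lt {N : ℕ} (x : GT N) {q p : Particle N} (h : q.NextIndexAbove p) :
    x.pos q < x.pos p := by
  obtain ⟨⟨k, hk⟩, ⟨i, hi⟩⟩ := q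
  obtain ⟨⟨k', hk'⟩, ⟨i', hi'⟩⟩ := p
  obtain ⟨h1, h2⟩ := h
  dsimp at h1 h2
  subst h1 h2
  exact (x.interlaces k hk' ⟨i, hi⟩).2

theorem GT.add_one_lt_of_below {N : ℕ} (x : GT N) {k : Fin N} {i j : Fin ((k : ℕ) + 1)}
    (hij : i < j)
    (h : ∀ q0 : Particle N, q0.SameIndexAbove ⟨k, i⟩ → x.pos ⟨k, i⟩ + 1 ≤ x.pos q0) :
    x.pos ⟨k, i⟩ + 1 < x.pos ⟨k, j⟩ := by
  obtain ⟨k, hk⟩ := k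
  obtain ⟨i, hi⟩ := i
  obtain ⟨j, hj⟩ := j
  have hij' : i < j := hij
  dsimp at hi hj
  obtain ⟨m, rfl⟩ : ∃ m, k = m + 1 := ⟨k - 1, by omega⟩
  have h1 := h ⟨⟨m, by omega⟩, ⟨i, by dsimp; omega⟩⟩ ⟨rfl, rfl⟩
  have h2 := x.pos_lt (q := ⟨⟨m, by omega⟩, ⟨i, by dsimp; omega⟩⟩)
    (p := ⟨⟨m + 1, hk⟩, ⟨i + 1, by dsimp; omega⟩⟩) ⟨rfl, rfl⟩
  have h3 : x.pos ⟨⟨m + 1, hk⟩, ⟨i + 1, by dsimp; omega⟩⟩ ≤ x.pos ⟨⟨m + 1, hk⟩, ⟨j, hj⟩⟩ :=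
    (x.level ⟨m + 1, hk⟩).strictMono.monotone (by simp only [Fin.mk_le_mk]; omega)
  omega

theorem Moves.add_one_le {N : ℕ} {x : GT N} {p q : Particle N} (hp : ¬ Blocked x p)
    (h : Moves x p q) :
    ∀ q0 : Particle N, q0.SameIndexAbove q → x.pos q + 1 ≤ x.pos q0 := by
  induction h with
  | self =>
    intro q0 h0
    have h1 := x.pos_le h0
    have h2 : x.pos q0 ≠ x.pos p := fun h => hp ⟨q0, h0, h⟩
    omega
  | push r q _ hrq hb ih =>
    intro q0 h0
    obtain ⟨⟨k, hk⟩, ⟨i, hi⟩⟩ := r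
    obtain ⟨⟨k', hk'⟩, ⟨j, hj⟩⟩ := q0
    have e : k' = k := by
      have := hrq.1
      have := h0.1
      dsimp at *
      omega
    subst e
    have hij : i < j := by
      have := hrq.2
      have := h0.2
      dsimp at *
      omega
    have := x.add_one_lt_of_below (k := ⟨k', hk⟩) (i := ⟨i, hi⟩) (j := ⟨j, hj⟩) hij ih
    omega

open Classical in
/-- The pattern after an unblocked jump of `p`, with all the pushes that it triggers. -/
def jump {N : ℕ} (x : GT N) (p : Particle N) (hp : ¬ Blocked x p) : GT N where
  level k :=
    { pos := fun i => x.pos ⟨k, i⟩ + if Moves x p ⟨k, i⟩ then 1 else 0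
      strictMono := by
        intro i j hij
        have h0 : x.pos ⟨k, i⟩ < x.pos ⟨k, j⟩ := (x.level k).strictMono hij
        dsimp only
        by_cases h : Moves x p ⟨k, i⟩
        · have := x.add_one_lt_of_below hij (h.add_one_le hp)
          rw [if_pos h]
          omega
        · rw [if_neg h]
          omega }
  interlaces := by
    intro k hk i
    dsimp only
    constructor
    · have h0 := x.pos_le (q := ⟨⟨k, Nat.lt_of_succ_lt hk⟩, i⟩)
        (p := ⟨⟨k + 1, hk⟩, i.castSucc⟩) ⟨rfl, rfl⟩
      by_cases h : Moves x p ⟨⟨k + 1, hk⟩, i.castSucc⟩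
      · have := h.add_one_le hp ⟨⟨k, Nat.lt_of_succ_lt hk⟩, i⟩ ⟨rfl, rfl⟩
        rw [if_pos h]
        omega
      · rw [if_neg h]
        omega
    · have hn : Particle.NextIndexAbove (N := N) ⟨⟨k, Nat.lt_of_succ_lt hk⟩, i⟩
        ⟨⟨k + 1, hk⟩, i.succ⟩ := ⟨rfl, rfl⟩
      have h0 := x.pos_lt hn
      by_cases h : Moves x p ⟨⟨k, Nat.lt_of_succ_lt hk⟩, i⟩
      · rw [if_pos h]
        by_cases hb : x.pos ⟨⟨k, Nat.lt_of_succ_lt hk⟩, i⟩ + 1 < x.pos ⟨⟨k + 1, hk⟩, i.succ⟩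
        · omega
        · rw [if_pos (Moves.push _ _ h hn hb)]
          omega
      · rw [if_neg h]
        omega

open Classical in
/-- The pattern after the clock of `p` rings: unchanged if `p` is blocked. -/
def ring {N : ℕ} (x : GT N) (p : Particle N) : GT N :=
  if hp : Blocked x p then x else jump x p hp

/-! ### Generators and the transition functions that they generate -/

/-- The rates are bounded away from `0` and `∞`. -/
def UB (rate : ℕ → ℝ) : Prop :=
  ∃ s M : ℝ, 0 < s ∧ ∀ x, s ≤ rate x ∧ rate x ≤ M

/-- The transition function `e^{tA}(x,y) = ∑ₘ tᵐ/m! (Aᵐ 𝟙_{y})(x)` generated by an operator `A`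
on functions. It is used only for generators with bounded jump rates, which are bounded in the
sup norm, so that the series converges absolutely. -/
def expKernel {S : Type*} (A : (S → ℝ) → (S → ℝ)) (t : ℝ) (x y : S) : ℝ :=
  ∑' m : ℕ, t ^ m / (m.factorial : ℝ) * (A^[m] (Set.indicator {y} 1)) x

/-- The generator of the pure-birth chain: from `x` to `x + 1` at rate `rate x`. -/
def birthGenerator (rate : ℕ → ℝ) (f : ℕ → ℝ) (x : ℕ) : ℝ :=
  rate x * (f (x + 1) - f x)

/-- The generator of the push-block dynamics: the clock of each particle rings independently, at
the rate attached to the current position of the particle. -/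
def pushBlockGenerator {N : ℕ} (rate : ℕ → ℝ) (f : GT N → ℝ) (x : GT N) : ℝ :=
  ∑ p : Particle N, rate (x.pos p) * (f (ring x p) - f x)

/-! ### The single level semigroups and the kernels between levels -/

/-- The Karlin-McGregor kernel `det (e^{tL}(xᵢ, yⱼ))`. -/
def karlinMcGregor (rate : ℕ → ℝ) {n : ℕ} (t : ℝ) (x y : Chamber n) : ℝ :=
  (Matrix.of fun i j : Fin n => expKernel (birthGenerator rate) t (x.pos i) (y.pos j)).det

open Classical in
/-- The kernel `Λ(x,y) = ∏ᵢ 1/λ(yᵢ) 𝟙(y ≺ x)`. -/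
def interlacingKernel (rate : ℕ → ℝ) {n : ℕ} (x : Chamber (n + 1)) (y : Chamber n) : ℝ :=
  if Interlaces y x then ∏ i : Fin n, (rate (y.pos i))⁻¹ else 0

/-- The functions `𝔥ₙ`: `𝔥₁ = 1` and `𝔥ₙ₊₁ = Λ 𝔥ₙ` (a sum with finitely many non-zero terms).
The value for `n = 0` plays no role. -/
def harmonic (rate : ℕ → ℝ) : (n : ℕ) → Chamber n → ℝ
  | 0, _ => 1
  | 1, _ => 1
  | n + 2, x => ∑' y : Chamber (n + 1), interlacingKernel rate x y * harmonic rate (n + 1) y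

/-- The Markov kernel `𝔏` from level `n + 1` to level `n`. -/
def levelKernel (rate : ℕ → ℝ) {n : ℕ} (x : Chamber (n + 1)) (y : Chamber n) : ℝ :=
  harmonic rate n y / harmonic rate (n + 1) x * interlacingKernel rate x y

/-- The transition function `𝔓ₜ` on level `n`. -/
def levelSemigroup (rate : ℕ → ℝ) {n : ℕ} (t : ℝ) (x y : Chamber n) : ℝ :=
  harmonic rate n y / harmonic rate n x * karlinMcGregor rate t x y

/-- The density on patterns with `N + 1` levels obtained from a density `m` on the top level by
applying successively the Markov kernels `𝔏`. -/
def gibbs (rate : ℕ → ℝ) {N : ℕ} (m : Chamber (N + 1) → ℝ) (x : GT (N + 1)) : ℝ :=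
  m (x.level (Fin.last N)) *
    ∏ k : Fin N, levelKernel rate (x.level k.succ) (x.level k.castSucc)

/-! ### Markov processes on countable state spaces -/

/-- `p` is a semigroup of Markov (stochastic) kernels. -/
structure IsMarkovSemigroup {S : Type*} (p : ℝ → S → S → ℝ) : Prop where
  nonneg : ∀ t, 0 ≤ t → ∀ x y, 0 ≤ p t x y
  hasSum_one : ∀ t, 0 ≤ t → ∀ x, HasSum (p t x) 1
  zero_self : ∀ x, p 0 x x = 1
  zero_ne : ∀ x y, x ≠ y → p 0 x y = 0
  chapman_kolmogorov : ∀ s t, 0 ≤ s → 0 ≤ t → ∀ x z,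
    HasSum (fun y => p s x y * p t y z) (p (s + t) x z)

/-- `X` is a Markov process with transition function `p` (on a countable state space `S`): for all
times `t₀ ≤ t₁ ≤ ⋯ ≤ tₙ` and states `x₀, …, xₙ`,
`ℙ(X(t₀) = x₀, …, X(tₙ) = xₙ) = ℙ(X(t₀) = x₀) ∏ᵢ p (tᵢ₊₁ - tᵢ) xᵢ xᵢ₊₁`. -/
structure IsMarkovProcess {Ω S : Type*} [MeasurableSpace Ω] [MeasurableSpace S]
    (μ : Measure Ω) (X : ℝ≥0 → Ω → S) (p : ℝ → S → S → ℝ) : Prop where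
  measurable : ∀ t, Measurable (X t)
  path : ∀ (n : ℕ) (t : Fin (n + 1) → ℝ≥0) (x : Fin (n + 1) → S), Monotone t →
    μ.real {ω | ∀ i, X (t i) ω = x i} =
      μ.real {ω | X (t 0) ω = x 0} *
        ∏ i : Fin n, p ((t i.succ : ℝ) - (t i.castSucc : ℝ)) (x i.castSucc) (x i.succ)

/-- `X` is the push-block process with rate function `rate`, started from the distribution on
patterns with density `m`. -/
structure IsPushBlockProcess {Ω : Type*} [MeasurableSpace Ω] (μ : Measure Ω) (rate : ℕ → ℝ)
    {N : ℕ} (m : GT N → ℝ) (X : ℝ≥0 → Ω → GT N) : Prop where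
  markov : IsMarkovProcess μ X (expKernel (pushBlockGenerator rate))
  initial : ∀ x, μ.real {ω | X 0 ω = x} = m x

end PushBlock

end

/-!
Densities on a countable state space are elements of `ℓ¹`, on which a bounded jump generator acts
as a bounded operator; transition functions become exponentials, and an intertwining of two
generators passes to their semigroups by expanding the exponential series.

The number `𝔥 x` is the total weight `∏ λ⁻¹` of the patterns with top level `x`, so the Gibbs
density over `x` is the weight divided by `𝔥 x`. Every unblocked jump can be traced back from the
last particle that moves; telescoping the resulting sums of `λ` along the interlacing pattern shows
that the push-block generator maps the Gibbs density over `x` to a combination of Gibbs densities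
over `x` and over the chambers reached from `x` by one step of the top level. Conservation of mass
then says that `𝔥` is harmonic for independent pure-birth chains killed at collisions, and the
identity itself says that the Gibbs kernel intertwines the Doob transform of the killed chains with
the push-block dynamics. By the Karlin–McGregor formula, the transition function of the Doob
transform is `𝔓`. The top level is then Markov by the criterion of Rogers and Pitman.

Particles are blocked and pushed only by lower ones, so the lower levels are again a push-block
process, with Gibbs initial law, and the remaining levels follow by induction.
-/

noncomputable section

namespace PushBlock

section Banach

variable {E F : Type*} [NormedAddCommGroup E] [NormedSpace ℝ E] [CompleteSpace E]
  [NormedAddCommGroup F] [NormedSpace ℝ F] [CompleteSpace F]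

theorem hasSum_exp_smul_apply (A : E →L[ℝ] E) (t : ℝ) (v : E) :
    HasSum (fun m : ℕ => (t ^ m / (m.factorial : ℝ)) • (A ^ m) v) (NormedSpace.exp (t • A) v) := by
  have h := (ContinuousLinearMap.apply ℝ E v).hasSum
    (NormedSpace.exp_series_hasSum_exp' (𝕂 := ℝ) (t • A))
  refine h.congr_fun fun m => ?_
  simp [smul_pow, smul_smul, div_eq_inv_mul]

theorem comp_exp_smul_of_comp_eq {A : E →L[ℝ] E} {A' : F →L[ℝ] F} {B : E →L[ℝ] F}
    (h : B.comp A = A'.comp B) (t : ℝ) :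
    B.comp (NormedSpace.exp (t • A)) = (NormedSpace.exp (t • A')).comp B := by
  have hpow (m : ℕ) (v : E) : B ((A ^ m) v) = (A' ^ m) (B v) := by
    induction m generalizing v with
    | zero => rfl
    | succ m ih => simp only [pow_succ, mul_apply_eq_comp, ih, show B (A v) = A' (B v) from
        DFunLike.congr_fun h v]
  ext1 v
  refine (B.hasSum (hasSum_exp_smul_apply A t v)).unique ?_
  simpa only [hpow, map_smul, ContinuousLinearMap.comp_apply] using
    hasSum_exp_smul_apply A' t (B v)

theorem exp_add_smul (A : E →L[ℝ] E) (s t : ℝ) :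
    NormedSpace.exp ((s + t) • A) = NormedSpace.exp (t • A) * NormedSpace.exp (s • A) := by
  let _ : NormedAlgebra ℚ (E →L[ℝ] E) := NormedAlgebra.restrictScalars ℚ ℝ _
  rw [add_comm, add_smul]
  exact NormedSpace.exp_add_of_commute (((Commute.refl A).smul_left t).smul_right s)

theorem exp_smul_add_smul_one (A : E →L[ℝ] E) (t c : ℝ) :
    NormedSpace.exp (t • (A + c • 1)) = Real.exp (t * c) • NormedSpace.exp (t • A) := by
  let _ : NormedAlgebra ℚ (E →L[ℝ] E) := NormedAlgebra.restrictScalars ℚ ℝ _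
  rw [smul_add, smul_smul,
    NormedSpace.exp_add_of_commute ((Commute.one_right _).smul_right _),
    ← Algebra.algebraMap_eq_smul_one, ← NormedSpace.algebraMap_exp_comm,
    Algebra.algebraMap_eq_smul_one, mul_smul_comm, mul_one, Real.exp_eq_exp_ℝ]

end Banach

/-! ### Summable functions -/

/-- The Banach space `ℓ¹(S)`. Signed measures on a countable state space live here, and transition
functions act on it as bounded operators. -/
abbrev L1 (S : Type*) : Type _ := lp (fun _ : S => ℝ) 1

namespace L1

variable {S S' : Type*}

theorem summable_norm (ν : L1 S) : Summable fun x => ‖ν x‖ := by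
  simpa using (lp.hasSum_norm (p := 1) (by simp) ν).summable

theorem summable (ν : L1 S) : Summable fun x => ν x := ν.summable_norm.of_norm

theorem norm_eq_tsum (ν : L1 S) : ‖ν‖ = ∑' x, ‖ν x‖ := by
  simpa using lp.norm_eq_tsum_rpow (p := 1) (by simp) ν

/-- A summable function as an element of `ℓ¹`. -/
def ofSummable (f : S → ℝ) (hf : Summable f) : L1 S :=
  ⟨f, memℓp_gen (by simpa using hf.norm)⟩

@[simp]
theorem ofSummable_apply (f : S → ℝ) (hf : Summable f) (x : S) : ofSummable f hf x = f x := rfl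

theorem norm_le_one_of_hasSum_one {ν : L1 S} (hν : ∀ x, 0 ≤ ν x) (h : HasSum (fun x => ν x) 1) :
    ‖ν‖ ≤ 1 := by
  simp only [norm_eq_tsum, Real.norm_of_nonneg (hν _), h.tsum_eq, le_refl]

open Classical in
/-- The point mass at `x`. -/
def dirac (x : S) : L1 S := lp.single 1 x 1

open Classical in
theorem dirac_apply (x y : S) : dirac x y = if x = y then 1 else 0 := by
  simp [dirac, lp.single_apply, Pi.single_apply, eq_comm]

@[simp]
theorem dirac_self (x : S) : dirac x x = 1 := by simp [dirac_apply]

theorem dirac_ne {x y : S} (h : x ≠ y) : dirac x y = 0 := by simp [dirac_apply, h]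

theorem dirac_nonneg (x y : S) : 0 ≤ dirac x y := by
  rw [dirac_apply]
  split_ifs <;> simp

theorem norm_dirac (x : S) : ‖dirac x‖ = 1 := by
  classical
  simp [dirac, lp.norm_single]

theorem hasSum_smul_dirac (ν : L1 S) : HasSum (fun x => ν x • dirac x) ν := by
  classical
  refine (lp.hasSum_single (p := 1) (by simp) ν).congr_fun fun x => ?_
  rw [dirac, ← lp.single_smul, smul_eq_mul, mul_one]

theorem sum_apply {ι : Type*} (s : Finset ι) (f : ι → L1 S) (x : S) :
    (∑ i ∈ s, f i) x = ∑ i ∈ s, f i x := by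
  rw [lp.coeFn_sum, Finset.sum_apply]

theorem smul_apply (c : ℝ) (ν : L1 S) (x : S) : (c • ν) x = c * ν x := rfl

theorem sub_apply (ν ν' : L1 S) (x : S) : (ν - ν') x = ν x - ν' x := rfl

/-- Evaluation at the point `y`, as a bounded functional. -/
def eval (y : S) : L1 S →L[ℝ] ℝ := lp.evalCLM ℝ (fun _ : S => ℝ) 1 y

@[simp]
theorem eval_apply (y : S) (ν : L1 S) : eval y ν = ν y := rfl

section Operators

variable {E : Type*} [NormedAddCommGroup E] [NormedSpace ℝ E]

theorem hasSum_apply (T : L1 S →L[ℝ] E) (ν : L1 S) :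
    HasSum (fun x => ν x • T (dirac x)) (T ν) := by
  simpa using ν.hasSum_smul_dirac.mapL T

theorem hasSum_apply_apply (T : L1 S →L[ℝ] L1 S') (ν : L1 S) (y : S') :
    HasSum (fun x => ν x * T (dirac x) y) (T ν y) := by
  simpa using hasSum_apply ((eval y).comp T) ν

theorem clm_ext {T T' : L1 S →L[ℝ] E} (h : ∀ x, T (dirac x) = T' (dirac x)) : T = T' := by
  ext1 ν
  refine (hasSum_apply T ν).unique ?_
  simpa only [h] using hasSum_apply T' ν

variable [CompleteSpace E]

/-- The bounded operator with prescribed bounded values on point masses. -/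
def lift (v : S → E) (C : ℝ) (hv : ∀ x, ‖v x‖ ≤ C) : L1 S →L[ℝ] E :=
  have norm_le (ν : L1 S) (x : S) : ‖ν x • v x‖ ≤ ‖ν x‖ * C := by
    rw [norm_smul]
    exact mul_le_mul_of_nonneg_left (hv x) (norm_nonneg _)
  have summable (ν : L1 S) : Summable fun x => ‖ν x • v x‖ :=
    (ν.summable_norm.mul_right C).of_nonneg_of_le (fun _ => norm_nonneg _) (norm_le ν)
  LinearMap.mkContinuous
    { toFun := fun ν => ∑' x, ν x • v x
      map_add' := fun ν ν' => by
        rw [← (summable ν).of_norm.tsum_add (summable ν').of_norm]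
        simp [add_smul]
      map_smul' := fun c ν => by
        rw [RingHom.id_apply, ← (summable ν).of_norm.tsum_const_smul]
        simp [mul_smul] } C fun ν => by
    rw [norm_eq_tsum, mul_comm, ← tsum_mul_right]
    exact (norm_tsum_le_tsum_norm (summable ν)).trans
      ((summable ν).tsum_le_tsum (norm_le ν) (ν.summable_norm.mul_right C))

theorem lift_apply (v : S → E) (C : ℝ) (hv : ∀ x, ‖v x‖ ≤ C) (ν : L1 S) :
    lift v C hv ν = ∑' x, ν x • v x := rfl

@[simp]
theorem lift_dirac (v : S → E) (C : ℝ) (hv : ∀ x, ‖v x‖ ≤ C) (x : S) :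
    lift v C hv (dirac x) = v x := by
  rw [lift_apply, tsum_eq_single x fun y hy => by rw [dirac_ne hy.symm, zero_smul], dirac_self,
    one_smul]

end Operators

/-- The total mass, as a bounded functional. -/
def mass : L1 S →L[ℝ] ℝ := lift (fun _ => 1) 1 (by simp)

@[simp]
theorem mass_dirac (x : S) : mass (dirac x) = 1 := by simp [mass]

theorem hasSum_mass (ν : L1 S) : HasSum (fun x => ν x) (mass ν) := by
  simpa using hasSum_apply mass ν

/-- Restriction to the subset `B`. -/
def restr (B : Set S) : L1 S →L[ℝ] L1 S :=
  lift (B.indicator dirac) 1 fun x => (norm_indicator_le_norm_self dirac x).trans_eq (norm_dirac x)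

@[simp]
theorem restr_dirac (B : Set S) (x : S) : restr B (dirac x) = B.indicator dirac x := by
  simp [restr]

theorem restr_apply (B : Set S) (ν : L1 S) (x : S) : restr B ν x = B.indicator ν x := by
  refine (hasSum_apply_apply (restr B) ν x).unique ?_
  have hx : ν x * restr B (dirac x) x = B.indicator ν x := by
    by_cases h : x ∈ B <;> simp [h]
  rw [← hx]
  refine hasSum_single x fun y hy => ?_
  by_cases h : y ∈ B <;> simp [h, dirac_ne hy]

/-- The pushforward along `φ`. -/
def map (φ : S → S') : L1 S →L[ℝ] L1 S' :=
  lift (fun x => dirac (φ x)) 1 fun _ => (norm_dirac _).le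

@[simp]
theorem map_dirac (φ : S → S') (x : S) : map φ (dirac x) = dirac (φ x) := by simp [map]

theorem map_apply (φ : S → S') (ν : L1 S) (z : S') :
    map φ ν z = mass (restr (φ ⁻¹' {z}) ν) := by
  suffices h : (eval z).comp (map φ) = mass.comp (restr (φ ⁻¹' {z})) from DFunLike.congr_fun h ν
  refine clm_ext fun x => ?_
  by_cases h : φ x = z <;> simp [Set.indicator, h, dirac_apply]

theorem map_restr_preimage (φ : S → S') (ν : L1 S) (z : S') :
    map φ (restr (φ ⁻¹' {z}) ν) = map φ ν z • dirac z := by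
  suffices h : (map φ).comp (restr (φ ⁻¹' {z})) = ((eval z).comp (map φ)).smulRight (dirac z) from
    DFunLike.congr_fun h ν
  refine clm_ext fun x => ?_
  by_cases h : φ x = z <;> simp [Set.indicator, h, dirac_apply]

theorem map_apply_of_forall_ne {φ : S → S'} {ν : L1 S} (x : S)
    (h : ∀ y, φ y = φ x → y ≠ x → ν y = 0) : map φ ν (φ x) = ν x := by
  rw [map_apply]
  refine (hasSum_mass _).unique ?_
  have hsingle := hasSum_single (f := fun y => restr (φ ⁻¹' {φ x}) ν y) x fun y hy => by
    rw [restr_apply]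
    exact Set.indicator_apply_eq_zero.2 fun hmem => h y hmem hy
  rwa [restr_apply, Set.indicator_of_mem (show x ∈ φ ⁻¹' {φ x} from rfl)] at hsingle

theorem map_apply_eq_zero {φ : S → S'} {ν : L1 S} {z : S'} (h : ∀ y, φ y = z → ν y = 0) :
    map φ ν z = 0 := by
  rw [map_apply]
  refine (hasSum_mass _).unique (hasSum_zero.congr_fun fun y => ?_)
  rw [restr_apply]
  exact Set.indicator_apply_eq_zero.2 (h y)

section Stochastic

variable {k : S → S' → ℝ} (hk : ∀ x y, 0 ≤ k x y) (hk1 : ∀ x, HasSum (k x) 1)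

/-- A stochastic kernel as an operator on densities. -/
def ofStochastic : L1 S →L[ℝ] L1 S' :=
  lift (fun x => ofSummable (k x) (hk1 x).summable) 1 fun x =>
    norm_le_one_of_hasSum_one (hk x) (hk1 x)

@[simp]
theorem ofStochastic_dirac_apply (x : S) (y : S') : ofStochastic hk hk1 (dirac x) y = k x y := by
  rw [ofStochastic, lift_dirac, ofSummable_apply]

theorem mass_ofStochastic (ν : L1 S) : mass (ofStochastic hk hk1 ν) = mass ν := by
  suffices h : mass.comp (ofStochastic hk hk1) = mass from DFunLike.congr_fun h ν
  refine clm_ext fun x => (hasSum_mass _).unique ?_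
  rw [mass_dirac]
  exact (hk1 x).congr_fun (ofStochastic_dirac_apply hk hk1 x)

end Stochastic

section Exponential

variable {A : L1 S →L[ℝ] L1 S}

theorem mass_exp_smul (h : ∀ x, mass (A (dirac x)) = 0) (t : ℝ) (ν : L1 S) :
    mass (NormedSpace.exp (t • A) ν) = mass ν := by
  have h0 : mass.comp A = (0 : ℝ →L[ℝ] ℝ).comp mass := clm_ext fun x => by simpa using h x
  simpa using DFunLike.congr_fun (comp_exp_smul_of_comp_eq h0 t) ν

theorem apply_nonneg (h : ∀ x y, 0 ≤ A (dirac x) y) {ν : L1 S} (hν : ∀ x, 0 ≤ ν x) (y : S) :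
    0 ≤ A ν y :=
  (hasSum_apply_apply A ν y).nonneg fun x => mul_nonneg (hν x) (h x y)

theorem pow_apply_nonneg (h : ∀ x y, 0 ≤ A (dirac x) y) {ν : L1 S} (hν : ∀ x, 0 ≤ ν x) (m : ℕ)
    (y : S) : 0 ≤ (A ^ m) ν y := by
  induction m generalizing y with
  | zero => exact hν y
  | succ m ih =>
    rw [pow_succ', mul_apply_eq_comp]
    exact apply_nonneg h ih y

theorem exp_smul_apply_nonneg (h : ∀ x y, 0 ≤ A (dirac x) y) {t : ℝ} (ht : 0 ≤ t) {ν : L1 S}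
    (hν : ∀ x, 0 ≤ ν x) (y : S) : 0 ≤ NormedSpace.exp (t • A) ν y := by
  refine ((eval y).hasSum (hasSum_exp_smul_apply A t ν)).nonneg fun m => ?_
  rw [map_smul]
  exact mul_nonneg (by positivity) (pow_apply_nonneg h hν m y)

/- `A` plus a multiple of the identity is positive, and the multiple of the identity only
contributes a scalar factor to the exponential. -/
theorem exp_smul_apply_nonneg_of_add {c : ℝ} (h : ∀ x y, 0 ≤ A (dirac x) y + c * dirac x y) {t : ℝ}
    (ht : 0 ≤ t) {ν : L1 S} (hν : ∀ x, 0 ≤ ν x) (y : S) : 0 ≤ NormedSpace.exp (t • A) ν y := by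
  have hpos : 0 ≤ NormedSpace.exp (t • (A + c • 1)) ν y := exp_smul_apply_nonneg h ht hν y
  rw [exp_smul_add_smul_one] at hpos
  exact nonneg_of_mul_nonneg_right hpos (Real.exp_pos _)

end Exponential

end L1

/-! ### Jump generators -/

section Jump

variable {S J : Type*} [Fintype J]

/-- The generator of a chain that jumps from `x` to `τ j x` at rate `r j x`, acting on functions. -/
def jumpGenerator (r : J → S → ℝ) (τ : J → S → S) (f : S → ℝ) (x : S) : ℝ :=
  ∑ j, r j x * (f (τ j x) - f x)

/-- The adjoint of a jump generator with bounded rates, acting on signed measures. -/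
def jumpDual (r : J → S → ℝ) (τ : J → S → S) (C : ℝ) (hr : ∀ j x, |r j x| ≤ C) :
    L1 S →L[ℝ] L1 S :=
  L1.lift (fun x => ∑ j, r j x • (L1.dirac (τ j x) - L1.dirac x)) (∑ _j : J, C * 2) fun x => by
    refine norm_sum_le_of_le _ fun j _ => ?_
    rw [norm_smul, Real.norm_eq_abs]
    refine mul_le_mul (hr j x) ?_ (norm_nonneg _) ((abs_nonneg _).trans (hr j x))
    refine (norm_sub_le _ _).trans ?_
    rw [L1.norm_dirac, L1.norm_dirac]
    norm_num

variable {r : J → S → ℝ} {τ : J → S → S} {C : ℝ} (hr : ∀ j x, |r j x| ≤ C)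

@[simp]
theorem jumpDual_dirac (x : S) : jumpDual r τ C hr (L1.dirac x) =
    ∑ j, r j x • (L1.dirac (τ j x) - L1.dirac x) := by
  simp [jumpDual]

theorem mass_jumpDual (ν : L1 S) : L1.mass (jumpDual r τ C hr ν) = 0 := by
  suffices h : L1.mass.comp (jumpDual r τ C hr) = 0 from DFunLike.congr_fun h ν
  exact L1.clm_ext fun x => by simp

theorem jumpDual_pow_dirac (m : ℕ) (x y : S) :
    (jumpDual r τ C hr ^ m) (L1.dirac x) y =
      ((jumpGenerator r τ)^[m] (Set.indicator {y} 1)) x := by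
  induction m generalizing x with
  | zero =>
    classical
    simp [L1.dirac_apply, Pi.single_apply]
  | succ m ih =>
    rw [pow_succ, mul_apply_eq_comp, jumpDual_dirac, Function.iterate_succ_apply', map_sum,
      L1.sum_apply, jumpGenerator]
    simp only [map_smul, map_sub, L1.smul_apply, L1.sub_apply, ih]

theorem expKernel_jumpGenerator (t : ℝ) (x y : S) :
    expKernel (jumpGenerator r τ) t x y =
      NormedSpace.exp (t • jumpDual r τ C hr) (L1.dirac x) y := by
  have h := (L1.eval y).hasSum (hasSum_exp_smul_apply (jumpDual r τ C hr) t (L1.dirac x))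
  rw [← L1.eval_apply, ← h.tsum_eq, expKernel]
  simp only [map_smul, L1.eval_apply, jumpDual_pow_dirac, smul_eq_mul]

theorem jumpDual_dirac_add_nonneg (hr0 : ∀ j x, 0 ≤ r j x) (x y : S) :
    0 ≤ jumpDual r τ C hr (L1.dirac x) y + (∑ _j : J, C) * L1.dirac x y := by
  rw [jumpDual_dirac, L1.sum_apply, Finset.sum_mul, ← Finset.sum_add_distrib]
  refine Finset.sum_nonneg fun j _ => ?_
  have hstay : 0 ≤ (C - r j x) * L1.dirac x y :=
    mul_nonneg (sub_nonneg.2 ((le_abs_self _).trans (hr j x))) (L1.dirac_nonneg x y)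
  have hjump : 0 ≤ r j x * L1.dirac (τ j x) y := mul_nonneg (hr0 j x) (L1.dirac_nonneg _ y)
  rw [L1.smul_apply, L1.sub_apply]
  linarith

theorem isMarkovSemigroup_jumpGenerator (hr0 : ∀ j x, 0 ≤ r j x) (hrC : ∀ j x, r j x ≤ C) :
    IsMarkovSemigroup (expKernel (jumpGenerator r τ)) := by
  have hr (j x) : |r j x| ≤ C := (abs_of_nonneg (hr0 j x)).trans_le (hrC j x)
  have hexp := expKernel_jumpGenerator (τ := τ) hr
  have hzero (x : S) : NormedSpace.exp ((0 : ℝ) • jumpDual r τ C hr) (L1.dirac x) = L1.dirac x := by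
    rw [zero_smul, NormedSpace.exp_zero, one_apply_eq_self]
  refine ⟨fun t ht x y => ?_, fun t _ x => ?_, fun x => ?_, fun x y hxy => ?_,
    fun s t _ _ x z => ?_⟩
  · rw [hexp]
    exact L1.exp_smul_apply_nonneg_of_add (jumpDual_dirac_add_nonneg hr hr0) ht
      (L1.dirac_nonneg x) y
  · have h := L1.hasSum_mass (NormedSpace.exp (t • jumpDual r τ C hr) (L1.dirac x))
    rw [L1.mass_exp_smul (fun x => mass_jumpDual hr (L1.dirac x)), L1.mass_dirac] at h
    exact h.congr_fun (hexp t x)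
  · rw [hexp, hzero, L1.dirac_self]
  · rw [hexp, hzero, L1.dirac_ne hxy]
  · simp only [hexp]
    rw [exp_add_smul, mul_apply_eq_comp]
    exact L1.hasSum_apply_apply _ _ _

end Jump

/-! ### Functions of Markov processes -/

section OfMeasure

variable {S S' : Type*} [Countable S] [MeasurableSpace S] [DiscreteMeasurableSpace S]

theorem hasSum_indicator_measureReal_singleton (ν : Measure S) [IsFiniteMeasure ν] (A : Set S) :
    HasSum (A.indicator fun x => ν.real {x}) (ν.real A) := by
  have h := Measure.tsum_indicator_apply_singleton ν A .of_discrete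
  have hfin (x : S) : A.indicator (fun x => ν {x}) x ≠ ⊤ := by
    by_cases hx : x ∈ A <;> simp [hx]
  have hsum := (ENNReal.summable_toReal (h ▸ measure_ne_top ν A)).hasSum
  rw [← ENNReal.tsum_toReal_eq hfin, h] at hsum
  refine hsum.congr_fun fun x => ?_
  by_cases hx : x ∈ A <;> simp [hx, measureReal_def]

/-- The element of `ℓ¹` given by a finite measure on a countable set. -/
def L1.ofMeasure (ν : Measure S) [IsFiniteMeasure ν] : L1 S :=
  L1.ofSummable (fun x => ν.real {x}) <| by
    simpa using (hasSum_indicator_measureReal_singleton ν Set.univ).summable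

variable {ν : Measure S} [IsFiniteMeasure ν]

@[simp]
theorem L1.ofMeasure_apply (x : S) : L1.ofMeasure ν x = ν.real {x} := rfl

theorem L1.restr_ofMeasure (B : Set S) :
    L1.restr B (L1.ofMeasure ν) = L1.ofMeasure (ν.restrict B) := by
  ext x
  rw [L1.restr_apply, L1.ofMeasure_apply, measureReal_restrict_apply .of_discrete]
  by_cases hx : x ∈ B <;> simp [hx]

theorem L1.mass_ofMeasure : L1.mass (L1.ofMeasure ν) = ν.real Set.univ :=
  (L1.hasSum_mass _).unique (by simpa using hasSum_indicator_measureReal_singleton ν Set.univ)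

theorem L1.map_ofMeasure_apply (φ : S → S') (z : S') :
    L1.map φ (L1.ofMeasure ν) z = ν.real (φ ⁻¹' {z}) := by
  rw [L1.map_apply, L1.restr_ofMeasure, L1.mass_ofMeasure, measureReal_restrict_apply_univ]

theorem L1.map_ofMeasure [Countable S'] [MeasurableSpace S'] [DiscreteMeasurableSpace S']
    (φ : S → S') : L1.map φ (L1.ofMeasure ν) = L1.ofMeasure (ν.map φ) := by
  ext z
  rw [L1.map_ofMeasure_apply, L1.ofMeasure_apply, map_measureReal_apply .of_discrete .of_discrete]

end OfMeasure

section Markov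

section Path

variable {Ω S : Type*} [MeasurableSpace Ω] [MeasurableSpace S] {μ : Measure Ω} {X : ℝ≥0 → Ω → S}
  {p : ℝ → S → S → ℝ}

theorem IsMarkovProcess.measurable_path (hX : IsMarkovProcess μ X p) {n : ℕ} (t : Fin n → ℝ≥0) :
    Measurable fun ω i => X (t i) ω :=
  measurable_pi_lambda _ fun i => hX.measurable (t i)

theorem IsMarkovProcess.measureReal_path_succ (hX : IsMarkovProcess μ X p) {n : ℕ}
    {t : Fin (n + 2) → ℝ≥0} (ht : Monotone t) (c : Fin (n + 1) → S) (y : S) :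
    μ.real {ω | (∀ i : Fin (n + 1), X (t i.castSucc) ω = c i) ∧ X (t (Fin.last (n + 1))) ω = y} =
      μ.real {ω | ∀ i : Fin (n + 1), X (t i.castSucc) ω = c i} *
        p ((t (Fin.last (n + 1)) : ℝ) - t (Fin.last n).castSucc) (c (Fin.last n)) y := by
  have hpast := hX.path n (t ∘ Fin.castSucc) c (ht.comp Fin.strictMono_castSucc.monotone)
  have hpath := hX.path (n + 1) t (Fin.snoc c y) ht
  simp only [Function.comp_apply] at hpast
  rw [hpast]
  rw [Fin.prod_univ_castSucc, ← mul_assoc] at hpath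
  simpa only [Fin.forall_fin_succ' (P := fun i => X (t i) _ = (Fin.snoc c y : Fin (n + 2) → S) i),
    Fin.snoc_castSucc, Fin.snoc_last, Fin.succ_castSucc, Fin.succ_last, Fin.castSucc_zero,
    show (Fin.snoc c y : Fin (n + 2) → S) 0 = c 0 from Fin.snoc_castSucc (α := fun _ => S) y c 0]
    using hpath

end Path

variable {Ω S S' : Type*} [MeasurableSpace Ω] [Countable S] [MeasurableSpace S]
  [DiscreteMeasurableSpace S] {μ : Measure Ω} [IsFiniteMeasure μ] {X : ℝ≥0 → Ω → S}
  {p : ℝ → S → S → ℝ}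

/- Both sides are sums over the possible pasts `c ∈ A`. -/
theorem IsMarkovProcess.ofMeasure_map_restrict (hX : IsMarkovProcess μ X p) {n : ℕ}
    {t : Fin (n + 2) → ℝ≥0} (ht : Monotone t) (A : Set (Fin (n + 1) → S)) {T : L1 S →L[ℝ] L1 S}
    (hT : ∀ x y, T (L1.dirac x) y = p ((t (Fin.last (n + 1)) : ℝ) - t (Fin.last n).castSucc) x y) :
    L1.ofMeasure ((μ.restrict {ω | (fun i : Fin (n + 1) => X (t i.castSucc) ω) ∈ A}).map
        (X (t (Fin.last (n + 1))))) =
      T (L1.ofMeasure ((μ.restrict {ω | (fun i : Fin (n + 1) => X (t i.castSucc) ω) ∈ A}).map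
        (X (t (Fin.last n).castSucc)))) := by
  set Y : Ω → Fin (n + 1) → S := fun ω i => X (t i.castSucc) ω
  have hY : Measurable Y := hX.measurable_path (t ∘ Fin.castSucc)
  have hnow : (μ.restrict (Y ⁻¹' A)).map (X (t (Fin.last n).castSucc)) =
      ((μ.map Y).restrict A).map fun c => c (Fin.last n) := by
    rw [Measure.restrict_map hY .of_discrete, Measure.map_map .of_discrete hY]
    rfl
  have hnext : L1.ofMeasure ((μ.restrict (Y ⁻¹' A)).map (X (t (Fin.last (n + 1))))) =
      (T ∘L L1.map (fun c => c (Fin.last n)) ∘L L1.restr A) (L1.ofMeasure (μ.map Y)) := by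
    ext y
    have hXy : MeasurableSet (X (t (Fin.last (n + 1))) ⁻¹' {y}) := hX.measurable _ .of_discrete
    have hsum := hasSum_indicator_measureReal_singleton
      ((μ.restrict (X (t (Fin.last (n + 1))) ⁻¹' {y})).map Y) A
    rw [map_measureReal_apply hY .of_discrete, measureReal_restrict_apply (hY .of_discrete),
      Set.inter_comm] at hsum
    rw [L1.ofMeasure_apply, map_measureReal_apply (hX.measurable _) .of_discrete,
      measureReal_restrict_apply hXy]
    refine hsum.unique ((L1.hasSum_apply_apply _ _ y).congr_fun fun c => ?_)
    by_cases hc : c ∈ A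
    · have hset : {ω | ∀ i : Fin (n + 1), X (t i.castSucc) ω = c i} = Y ⁻¹' {c} :=
        Set.ext fun ω => funext_iff.symm
      have hset' : {ω | (∀ i : Fin (n + 1), X (t i.castSucc) ω = c i) ∧
          X (t (Fin.last (n + 1))) ω = y} = Y ⁻¹' {c} ∩ X (t (Fin.last (n + 1))) ⁻¹' {y} :=
        Set.ext fun ω => and_congr_left' funext_iff.symm
      have hpath := hX.measureReal_path_succ ht c y
      rw [hset, hset'] at hpath
      simpa [hc, hT, map_measureReal_apply hY, measureReal_restrict_apply (hY (.singleton c))]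
        using hpath
    · simp [hc]
  change L1.ofMeasure ((μ.restrict (Y ⁻¹' A)).map _) =
    T (L1.ofMeasure ((μ.restrict (Y ⁻¹' A)).map _))
  simp only [hnow, hnext, ← L1.map_ofMeasure, ← L1.restr_ofMeasure, ContinuousLinearMap.comp_apply]

/-- The law of `X (t n)` on the event that `X (t i) ∈ B i` for all `i < n`. -/
def restrictedLaw (μ : Measure Ω) [IsFiniteMeasure μ] (X : ℝ≥0 → Ω → S) {n : ℕ}
    (B : Fin n → Set S) (t : Fin (n + 1) → ℝ≥0) : L1 S :=
  L1.ofMeasure ((μ.restrict {ω | ∀ i : Fin n, X (t i.castSucc) ω ∈ B i}).map (X (t (Fin.last n))))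

theorem map_restrictedLaw (hX : ∀ t, Measurable (X t)) (φ : S → S') {n : ℕ}
    (z : Fin (n + 1) → S') (t : Fin (n + 1) → ℝ≥0) :
    L1.map φ (restrictedLaw μ X (fun i : Fin n => φ ⁻¹' {z i.castSucc}) t) (z (Fin.last n)) =
      μ.real {ω | ∀ i, φ (X (t i) ω) = z i} := by
  rw [restrictedLaw, L1.map_ofMeasure_apply, map_measureReal_apply (hX _) .of_discrete,
    measureReal_restrict_apply (hX _ .of_discrete)]
  congr 1
  ext ω
  exact and_comm.trans (Fin.forall_fin_succ' (P := fun i => φ (X (t i) ω) = z i)).symm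

theorem IsMarkovProcess.restrictedLaw_succ (hX : IsMarkovProcess μ X p) {n : ℕ}
    {t : Fin (n + 2) → ℝ≥0} (ht : Monotone t) (B : Fin (n + 1) → Set S) {T : L1 S →L[ℝ] L1 S}
    (hT : ∀ x y, T (L1.dirac x) y = p ((t (Fin.last (n + 1)) : ℝ) - t (Fin.last n).castSucc) x y) :
    restrictedLaw μ X B t = T (L1.restr (B (Fin.last n))
      (restrictedLaw μ X (fun i : Fin n => B i.castSucc) fun i => t i.castSucc)) := by
  have hlast : MeasurableSet (X (t (Fin.last n).castSucc) ⁻¹' B (Fin.last n)) :=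
    hX.measurable _ .of_discrete
  have hset : {ω | ∀ i : Fin (n + 1), X (t i.castSucc) ω ∈ B i} =
      X (t (Fin.last n).castSucc) ⁻¹' B (Fin.last n) ∩
        {ω | ∀ i : Fin n, X (t i.castSucc.castSucc) ω ∈ B i.castSucc} :=
    Set.ext fun ω => Fin.forall_fin_succ'.trans and_comm
  have hstep := hX.ofMeasure_map_restrict ht {c | ∀ i, c i ∈ B i} hT
  simp only [Set.mem_ofPred_eq] at hstep
  simp only [restrictedLaw, hstep, L1.restr_ofMeasure]
  simp only [Measure.restrict_map (hX.measurable _) (MeasurableSet.of_discrete (s := B _)),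
    Measure.restrict_restrict hlast, hset]

theorem IsMarkovProcess.ofMeasure_map (hX : IsMarkovProcess μ X p) (t : ℝ≥0)
    {T : L1 S →L[ℝ] L1 S} (hT : ∀ x y, T (L1.dirac x) y = p t x y) :
    L1.ofMeasure (μ.map (X t)) = T (L1.ofMeasure (μ.map (X 0))) := by
  have hmono : Monotone ![0, t] := Fin.monotone_iff_le_succ.2 (by simp)
  simpa using hX.ofMeasure_map_restrict hmono Set.univ (by simpa using hT)

theorem IsMarkovProcess.comp_of_step [MeasurableSpace S'] (hX : IsMarkovProcess μ X p)
    {φ : S → S'} {q : ℝ → S' → S' → ℝ}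
    (h : ∀ (n : ℕ) (t : Fin (n + 2) → ℝ≥0) (z : Fin (n + 2) → S'), Monotone t →
      L1.map φ (restrictedLaw μ X (fun i => φ ⁻¹' {z i.castSucc}) t) (z (Fin.last (n + 1))) =
        L1.map φ (restrictedLaw μ X (fun i => φ ⁻¹' {z i.castSucc.castSucc})
          fun i => t i.castSucc) (z (Fin.last n).castSucc) *
        q ((t (Fin.last (n + 1)) : ℝ) - t (Fin.last n).castSucc)
          (z (Fin.last n).castSucc) (z (Fin.last (n + 1)))) :
    IsMarkovProcess μ (fun t ω => φ (X t ω)) q where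
  measurable t := .comp .of_discrete (hX.measurable t)
  path n t z ht := by
    induction n with
    | zero => simp
    | succ n ih =>
      have hpast := ih (fun i => t i.castSucc) (fun i => z i.castSucc)
        (ht.comp Fin.strictMono_castSucc.monotone)
      rw [← map_restrictedLaw hX.measurable] at hpast ⊢
      rw [h n t z ht, hpast, Fin.prod_univ_castSucc, mul_assoc]
      rfl

theorem IsMarkovProcess.comp_of_lumping [MeasurableSpace S'] (hX : IsMarkovProcess μ X p)
    {φ : S → S'} {q : ℝ → S' → S' → ℝ}
    {T : ℝ → L1 S →L[ℝ] L1 S} (hT : ∀ t x y, T t (L1.dirac x) y = p t x y)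
    {Q : ℝ → L1 S' →L[ℝ] L1 S'} (hQ : ∀ t x y, Q t (L1.dirac x) y = q t x y)
    (hTQ : ∀ t, (L1.map φ).comp (T t) = (Q t).comp (L1.map φ)) :
    IsMarkovProcess μ (fun t ω => φ (X t ω)) q := by
  refine hX.comp_of_step fun n t z ht => ?_
  have hcomm (s : ℝ) (ν : L1 S) : L1.map φ (T s ν) = Q s (L1.map φ ν) :=
    DFunLike.congr_fun (hTQ s) ν
  rw [hX.restrictedLaw_succ ht _ (hT _), hcomm, L1.map_restr_preimage, map_smul, L1.smul_apply, hQ]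

end Markov

section Intertwining

variable {S S' : Type*} {φ : S → S'} {Λ : L1 S' →L[ℝ] L1 S}

theorem L1.restr_preimage_of_supported (hsupp : ∀ z x, φ x ≠ z → Λ (L1.dirac z) x = 0)
    (ν : L1 S') (z : S') : L1.restr (φ ⁻¹' {z}) (Λ ν) = ν z • Λ (L1.dirac z) := by
  suffices h : (L1.restr (φ ⁻¹' {z})).comp Λ = (L1.eval z).smulRight (Λ (L1.dirac z)) from
    DFunLike.congr_fun h ν
  refine L1.clm_ext fun w => ?_
  ext x
  simp only [ContinuousLinearMap.comp_apply, L1.restr_apply, ContinuousLinearMap.smulRight_apply,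
    L1.eval_apply, L1.smul_apply]
  by_cases hx : φ x = z <;> rcases eq_or_ne w z with rfl | hwz
  · simp [hx]
  · simp [hx, L1.dirac_ne hwz, hsupp w x (hx.trans_ne hwz.symm)]
  · simp [hx, hsupp w x hx]
  · simp [hx, L1.dirac_ne hwz]

theorem L1.map_apply_of_supported (hsupp : ∀ z x, φ x ≠ z → Λ (L1.dirac z) x = 0)
    (hmass : ∀ z, L1.mass (Λ (L1.dirac z)) = 1) (ν : L1 S') (z : S') :
    L1.map φ (Λ ν) z = ν z := by
  rw [L1.map_apply, L1.restr_preimage_of_supported hsupp, map_smul, hmass, smul_eq_mul, mul_one]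

variable {Ω : Type*} [MeasurableSpace Ω] [Countable S] [MeasurableSpace S]
  [DiscreteMeasurableSpace S] {μ : Measure Ω} [IsFiniteMeasure μ] {X : ℝ≥0 → Ω → S}
  {p : ℝ → S → S → ℝ} {T : ℝ → L1 S →L[ℝ] L1 S} {Q : ℝ → L1 S' →L[ℝ] L1 S'} {m : L1 S'}

theorem IsMarkovProcess.ofMeasure_map_of_intertwining (hX : IsMarkovProcess μ X p)
    (hT : ∀ t x y, T t (L1.dirac x) y = p t x y) (hTQ : ∀ t, Λ.comp (Q t) = (T t).comp Λ)
    (hm : L1.ofMeasure (μ.map (X 0)) = Λ m) (t : ℝ≥0) :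
    L1.ofMeasure (μ.map (X t)) = Λ (Q t m) := by
  rw [hX.ofMeasure_map t (hT t), hm]
  exact (DFunLike.congr_fun (hTQ t) m).symm

theorem IsMarkovProcess.exists_restrictedLaw_eq_of_intertwining (hX : IsMarkovProcess μ X p)
    (hT : ∀ t x y, T t (L1.dirac x) y = p t x y) (hTQ : ∀ t, Λ.comp (Q t) = (T t).comp Λ)
    (hsupp : ∀ z x, φ x ≠ z → Λ (L1.dirac z) x = 0) (hm : L1.ofMeasure (μ.map (X 0)) = Λ m)
    {n : ℕ} (z : Fin n → S') {t : Fin (n + 1) → ℝ≥0} (ht : Monotone t) :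
    ∃ ν, restrictedLaw μ X (fun i => φ ⁻¹' {z i}) t = Λ ν := by
  induction n with
  | zero =>
    exact ⟨Q (t 0) m, by
      simpa [restrictedLaw] using hX.ofMeasure_map_of_intertwining hT hTQ hm (t 0)⟩
  | succ n ih =>
    obtain ⟨ν, hν⟩ := ih (fun i => z i.castSucc) (ht.comp Fin.strictMono_castSucc.monotone)
    simp only [Function.comp_def] at hν
    rw [hX.restrictedLaw_succ ht _ (hT _), hν, L1.restr_preimage_of_supported hsupp, ← map_smul]
    exact ⟨_, (DFunLike.congr_fun (hTQ _) _).symm⟩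

/- The criterion of Rogers and Pitman: by induction on the number of observations, the law of `X`
conditioned on the past of `φ ∘ X` remains in the range of `Λ`. -/
theorem IsMarkovProcess.comp_of_intertwining [MeasurableSpace S'] (hX : IsMarkovProcess μ X p)
    (hT : ∀ t x y, T t (L1.dirac x) y = p t x y) {q : ℝ → S' → S' → ℝ}
    (hQ : ∀ t x y, Q t (L1.dirac x) y = q t x y) (hTQ : ∀ t, Λ.comp (Q t) = (T t).comp Λ)
    (hsupp : ∀ z x, φ x ≠ z → Λ (L1.dirac z) x = 0) (hmass : ∀ z, L1.mass (Λ (L1.dirac z)) = 1)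
    (hm : L1.ofMeasure (μ.map (X 0)) = Λ m) :
    IsMarkovProcess μ (fun t ω => φ (X t ω)) q := by
  refine hX.comp_of_step fun n t z ht => ?_
  have hcomm (s : ℝ) (ν : L1 S') : T s (Λ ν) = Λ (Q s ν) := (DFunLike.congr_fun (hTQ s) ν).symm
  obtain ⟨ν, hν⟩ := hX.exists_restrictedLaw_eq_of_intertwining hT hTQ hsupp hm
    (fun i : Fin n => z i.castSucc.castSucc) (ht.comp Fin.strictMono_castSucc.monotone)
  simp only [Function.comp_def] at hν
  rw [hX.restrictedLaw_succ ht _ (hT _), hν, L1.restr_preimage_of_supported hsupp, map_smul, hcomm,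
    map_smul, L1.smul_apply, L1.map_apply_of_supported hsupp hmass,
    L1.map_apply_of_supported hsupp hmass, hQ]

end Intertwining

/-! ### The Karlin-McGregor determinant -/

section Determinant

open PowerSeries

theorem derivation_prod {R A ι : Type*} [CommRing R] [CommRing A] [Algebra R A] [DecidableEq ι]
    (D : Derivation R A A) (s : Finset ι) (f : ι → A) :
    D (∏ i ∈ s, f i) = ∑ k ∈ s, ∏ i ∈ s, if i = k then D (f i) else f i := by
  induction s using Finset.induction_on with
  | empty => simp
  | insert a s ha ih =>
    rw [Finset.prod_insert ha, D.leibniz, ih, Finset.sum_insert ha, Finset.prod_insert ha,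
      if_pos rfl, add_comm, smul_eq_mul, smul_eq_mul, Finset.mul_sum, mul_comm]
    congr 1
    · congr 1
      refine Finset.prod_congr rfl fun i hi => ?_
      rw [if_neg (ne_of_mem_of_not_mem hi ha)]
    · refine Finset.sum_congr rfl fun k hk => ?_
      rw [Finset.prod_insert ha, if_neg (ne_of_mem_of_not_mem hk ha).symm]

theorem derivation_det {R A ι : Type*} [CommRing R] [CommRing A] [Algebra R A] [DecidableEq ι]
    [Fintype ι] (D : Derivation R A A) (M : Matrix ι ι A) :
    D M.det = ∑ k, (M.updateRow k fun j => D (M k j)).det := by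
  simp only [← Matrix.det_transpose (M := M), ← Matrix.det_transpose (M := M.updateRow _ _),
    Matrix.det_apply, Matrix.transpose_apply]
  rw [Finset.sum_comm, map_sum]
  refine Finset.sum_congr rfl fun σ _ => ?_
  rw [← Finset.smul_sum, Units.smul_def, Units.smul_def, map_zsmul, derivation_prod]
  congr 1
  refine Finset.sum_congr rfl fun k _ => Finset.prod_congr rfl fun i _ => ?_
  rw [Matrix.updateRow_apply]
  split_ifs with hik
  · rw [hik]
  · rfl

/-- The power series `f` converges at `t`, with sum `v`. -/
def Evaluates (t : ℝ) (f : ℝ⟦X⟧) (v : ℝ) : Prop :=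
  HasSum (fun m => coeff m f * t ^ m) v

theorem Evaluates.mul {t : ℝ} {f g : ℝ⟦X⟧} {v w : ℝ} (hf : Evaluates t f v)
    (hg : Evaluates t g w) : Evaluates t (f * g) (v * w) := by
  have hcauchy (m : ℕ) : coeff m (f * g) * t ^ m = ∑ kl ∈ Finset.HasAntidiagonal.antidiagonal m,
      (coeff kl.1 f * t ^ kl.1) * (coeff kl.2 g * t ^ kl.2) := by
    rw [coeff_mul, Finset.sum_mul]
    refine Finset.sum_congr rfl fun kl hkl => ?_
    rw [← Finset.HasAntidiagonal.mem_antidiagonal.1 hkl, pow_add]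
    ring
  have hsum := (summable_norm_sum_mul_antidiagonal_of_summable_norm hf.summable.norm
    hg.summable.norm).of_norm.hasSum
  rw [← tsum_mul_tsum_eq_tsum_sum_antidiagonal_of_summable_norm hf.summable.norm hg.summable.norm,
    hf.tsum_eq, hg.tsum_eq] at hsum
  exact hsum.congr_fun hcauchy

theorem Evaluates.one (t : ℝ) : Evaluates t 1 1 := by
  simpa [Evaluates] using hasSum_single (f := fun m => coeff m (1 : ℝ⟦X⟧) * t ^ m) 0 fun m hm => by
    simp [coeff_one, hm]

theorem Evaluates.zsmul {t : ℝ} {f : ℝ⟦X⟧} {v : ℝ} (c : ℤ) (hf : Evaluates t f v) :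
    Evaluates t (c • f) (c • v) := by
  refine (hf.const_smul c).congr_fun fun m => ?_
  rw [map_zsmul, smul_mul_assoc]

theorem Evaluates.sum {ι : Type*} {t : ℝ} {s : Finset ι} {f : ι → ℝ⟦X⟧} {v : ι → ℝ}
    (h : ∀ i ∈ s, Evaluates t (f i) (v i)) : Evaluates t (∑ i ∈ s, f i) (∑ i ∈ s, v i) := by
  refine (hasSum_sum h).congr_fun fun m => ?_
  rw [map_sum, Finset.sum_mul]

theorem Evaluates.prod {ι : Type*} {t : ℝ} {s : Finset ι} {f : ι → ℝ⟦X⟧} {v : ι → ℝ}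
    (h : ∀ i ∈ s, Evaluates t (f i) (v i)) : Evaluates t (∏ i ∈ s, f i) (∏ i ∈ s, v i) := by
  classical
  induction s using Finset.induction_on with
  | empty => simpa using Evaluates.one t
  | insert a s ha ih =>
    rw [Finset.prod_insert ha, Finset.prod_insert ha]
    exact (h a (Finset.mem_insert_self a s)).mul
      (ih fun i hi => h i (Finset.mem_insert_of_mem hi))

theorem Evaluates.det {ι : Type*} [DecidableEq ι] [Fintype ι] {t : ℝ}
    {F : Matrix ι ι ℝ⟦X⟧} {V : Matrix ι ι ℝ} (h : ∀ i j, Evaluates t (F i j) (V i j)) :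
    Evaluates t F.det V.det := by
  rw [Matrix.det_apply, Matrix.det_apply]
  exact Evaluates.sum fun σ _ => (Evaluates.prod fun i _ => h _ _).zsmul _

/-- The `i`-th particle of `x` can jump without hitting the next one. -/
def Chamber.CanRaise {n : ℕ} (x : Chamber n) (i : Fin n) : Prop :=
  ∀ j, i < j → x.pos i + 1 < x.pos j

open Classical in
/-- The configuration after a jump of the `i`-th particle; unchanged if the jump is impossible. -/
def Chamber.raise {n : ℕ} (x : Chamber n) (i : Fin n) : Chamber n :=
  if h : x.CanRaise i then
    { pos := Function.update x.pos i (x.pos i + 1)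
      strictMono := by
        intro j k hjk
        have h0 := x.strictMono hjk
        simp only [Function.update_apply]
        split_ifs with h1 h2 h2
        · omega
        · subst h1
          exact h k hjk
        · subst h2
          omega
        · exact h0 }
  else x

theorem Chamber.raise_pos {n : ℕ} {x : Chamber n} {i : Fin n} (h : x.CanRaise i) :
    (x.raise i).pos = Function.update x.pos i (x.pos i + 1) := by
  rw [Chamber.raise, dif_pos h]

open Classical in
/-- The generator of independent pure-birth chains killed at their first collision. -/
def killedGenerator (rate : ℕ → ℝ) {n : ℕ} (f : Chamber n → ℝ) (x : Chamber n) : ℝ :=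
  ∑ i, rate (x.pos i) * ((if x.CanRaise i then f (x.raise i) else 0) - f x)

/-- The exponential series of the pure-birth generator. -/
def birthSeries (rate : ℕ → ℝ) (a b : ℕ) : ℝ⟦X⟧ :=
  PowerSeries.mk fun m =>
    ((birthGenerator rate)^[m] (Set.indicator {b} 1)) a / (m.factorial : ℝ)

theorem derivative_birthSeries (rate : ℕ → ℝ) (a b : ℕ) :
    derivative ℝ (birthSeries rate a b) =
      C (rate a) * (birthSeries rate (a + 1) b - birthSeries rate a b) := by
  ext m
  rw [coeff_derivative, coeff_C_mul, map_sub]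
  simp only [birthSeries, coeff_mk, Function.iterate_succ_apply', Nat.factorial_succ]
  rw [birthGenerator]
  have : (m.factorial : ℝ) ≠ 0 := by positivity
  push_cast
  field_simp

theorem birthGenerator_eq (rate : ℕ → ℝ) :
    birthGenerator rate = jumpGenerator (J := Unit) (fun _ => rate) (fun _ x => x + 1) := by
  funext f x
  simp [birthGenerator, jumpGenerator]

theorem evaluates_birthSeries {rate : ℕ → ℝ} {M : ℝ} (hM : ∀ a, |rate a| ≤ M) (t : ℝ) (a b : ℕ) :
    Evaluates t (birthSeries rate a b) (expKernel (birthGenerator rate) t a b) := by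
  rw [birthGenerator_eq, expKernel_jumpGenerator fun _ => hM]
  refine ((L1.eval b).hasSum (hasSum_exp_smul_apply _ t (L1.dirac a))).congr_fun fun m => ?_
  rw [map_smul, L1.eval_apply, jumpDual_pow_dirac, birthSeries, coeff_mk, birthGenerator_eq,
    smul_eq_mul]
  ring

/-- The determinant of the exponential series of the pure-birth generator. -/
def detSeries (rate : ℕ → ℝ) {n : ℕ} (x y : Fin n → ℕ) : ℝ⟦X⟧ :=
  (Matrix.of fun i j : Fin n => birthSeries rate (x i) (y j)).det

theorem derivative_detSeries (rate : ℕ → ℝ) {n : ℕ} (x y : Fin n → ℕ) :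
    derivative ℝ (detSeries rate x y) = ∑ i, C (rate (x i)) *
      (detSeries rate (Function.update x i (x i + 1)) y - detSeries rate x y) := by
  rw [detSeries, derivation_det]
  refine Finset.sum_congr rfl fun k _ => ?_
  set B : Matrix (Fin n) (Fin n) ℝ⟦X⟧ := Matrix.of fun i j => birthSeries rate (x i) (y j) with hB
  have hrow : (fun j => derivative ℝ (B k j)) =
      C (rate (x k)) • ((fun j => birthSeries rate (x k + 1) (y j)) + (-1 : ℝ⟦X⟧) • B k) := by
    funext j
    simp only [hB, Matrix.of_apply, derivative_birthSeries, Pi.smul_apply, Pi.add_apply,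
      smul_eq_mul]
    ring
  have hupdate : B.updateRow k (fun j => birthSeries rate (x k + 1) (y j)) =
      Matrix.of fun i j => birthSeries rate (Function.update x k (x k + 1) i) (y j) := by
    ext1 i j
    rw [Matrix.updateRow_apply, Matrix.of_apply, hB, Matrix.of_apply, Function.update_apply]
    split_ifs <;> rfl
  rw [hrow, Matrix.det_updateRow_smul, Matrix.det_updateRow_add, Matrix.det_updateRow_smul,
    Matrix.updateRow_eq_self, hupdate, detSeries, neg_one_mul, sub_eq_add_neg]

open Classical in
theorem derivative_detSeries_chamber (rate : ℕ → ℝ) {n : ℕ} (x y : Chamber n) :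
    derivative ℝ (detSeries rate x.pos y.pos) = ∑ i, C (rate (x.pos i)) *
      ((if x.CanRaise i then detSeries rate (x.raise i).pos y.pos else 0) -
        detSeries rate x.pos y.pos) := by
  rw [derivative_detSeries]
  refine Finset.sum_congr rfl fun i _ => ?_
  congr 2
  split_ifs with h
  · rw [Chamber.raise_pos h]
  · simp only [Chamber.CanRaise, not_forall] at h
    obtain ⟨j, hij, h⟩ := h
    have hj : x.pos i + 1 = x.pos j := le_antisymm (x.strictMono hij) (not_lt.1 h)
    refine Matrix.det_zero_of_row_eq hij.ne ?_
    funext k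
    rw [Matrix.of_apply, Matrix.of_apply, Function.update_self, Function.update_of_ne hij.ne', hj]

open Classical in
theorem det_indicator {n : ℕ} (x y : Chamber n) :
    (Matrix.of fun i j : Fin n => if x.pos i = y.pos j then (1 : ℝ) else 0).det =
      if x = y then 1 else 0 := by
  split_ifs with h
  · subst h
    convert Matrix.det_one (n := Fin n) (R := ℝ)
    ext i j
    simp [Matrix.one_apply, x.strictMono.injective.eq_iff]
  · rw [Matrix.det_apply]
    refine Finset.sum_eq_zero fun σ _ => ?_
    suffices hσ : ∃ i, x.pos (σ i) ≠ y.pos i by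
      obtain ⟨i, hi⟩ := hσ
      rw [Finset.prod_eq_zero (Finset.mem_univ i) (by simp [hi]), smul_zero]
    by_contra! hσ
    refine h (Chamber.ext ((StrictMono.range_inj x.strictMono y.strictMono).1 ?_))
    rw [show y.pos = x.pos ∘ σ from funext fun i => (hσ i).symm, Set.range_comp,
      Equiv.range_eq_univ, Set.image_univ]

open Classical in
theorem coeff_zero_detSeries (rate : ℕ → ℝ) {n : ℕ} (x y : Chamber n) :
    coeff 0 (detSeries rate x.pos y.pos) = if x = y then 1 else 0 := by
  rw [← det_indicator, coeff_zero_eq_constantCoeff_apply, detSeries, RingHom.map_det]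
  congr 1
  ext i j
  simp [birthSeries, ← coeff_zero_eq_constantCoeff_apply, Pi.single_apply]

/- Both sides satisfy the same recursion in `m`: the collision terms of the derivative of the
determinant vanish because two of its rows coincide. -/
theorem coeff_detSeries (rate : ℕ → ℝ) {n : ℕ} (y : Chamber n) (m : ℕ) (x : Chamber n) :
    coeff m (detSeries rate x.pos y.pos) =
      ((killedGenerator rate)^[m] (Set.indicator {y} 1)) x / (m.factorial : ℝ) := by
  classical
  induction m generalizing x with
  | zero => simp [coeff_zero_detSeries, Pi.single_apply]
  | succ m ih =>
    have hrec : coeff (m + 1) (detSeries rate x.pos y.pos) * (m + 1) =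
        killedGenerator rate ((killedGenerator rate)^[m] (Set.indicator {y} 1)) x /
          (m.factorial : ℝ) := by
      rw [← coeff_derivative, derivative_detSeries_chamber, map_sum, killedGenerator,
        Finset.sum_div]
      refine Finset.sum_congr rfl fun i _ => ?_
      rw [coeff_C_mul, map_sub, ih, mul_div_assoc, sub_div]
      split_ifs
      · rw [ih]
      · rw [map_zero, zero_div]
    rw [Function.iterate_succ_apply', Nat.factorial_succ, Nat.cast_mul, mul_comm, ← div_div, ← hrec,
      Nat.cast_succ, mul_div_cancel_right₀ _ (Nat.cast_add_one_ne_zero m)]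

theorem hasSum_karlinMcGregor {rate : ℕ → ℝ} {M : ℝ} (hM : ∀ a, |rate a| ≤ M) {n : ℕ} (t : ℝ)
    (x y : Chamber n) :
    HasSum (fun m : ℕ => t ^ m / (m.factorial : ℝ) *
      ((killedGenerator rate)^[m] (Set.indicator {y} 1)) x) (karlinMcGregor rate t x y) := by
  have h : Evaluates t (detSeries rate x.pos y.pos) (karlinMcGregor rate t x y) :=
    Evaluates.det fun i j => evaluates_birthSeries hM t _ _
  refine h.congr_fun fun m => ?_
  rw [coeff_detSeries]
  ring

end Determinant

/-! ### Doob transforms of the killed generator -/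

section DoobTransform

variable {rate : ℕ → ℝ} {n : ℕ} {h : Chamber n → ℝ}

open Classical in
/-- The jump rates of the Doob transform by `h` of the killed pure-birth chains. -/
def doobRate (rate : ℕ → ℝ) {n : ℕ} (h : Chamber n → ℝ) (i : Fin n) (x : Chamber n) : ℝ :=
  if x.CanRaise i then rate (x.pos i) * (h (x.raise i) / h x) else 0

/-- The generator of the Doob transform by `h` of the killed pure-birth chains. -/
def doobGenerator (rate : ℕ → ℝ) {n : ℕ} (h : Chamber n → ℝ) :
    (Chamber n → ℝ) → Chamber n → ℝ :=
  jumpGenerator (doobRate rate h) fun i x => x.raise i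

theorem sum_doobRate {x : Chamber n} (hne : h x ≠ 0) (hharm : killedGenerator rate h x = 0) :
    ∑ i, doobRate rate h i x = ∑ i, rate (x.pos i) := by
  suffices hx : (∑ i, doobRate rate h i x - ∑ i, rate (x.pos i)) * h x =
      killedGenerator rate h x from
    sub_eq_zero.1 ((mul_eq_zero.1 (hx.trans hharm)).resolve_right hne)
  rw [killedGenerator, ← Finset.sum_sub_distrib, Finset.sum_mul]
  refine Finset.sum_congr rfl fun i _ => ?_
  rw [doobRate]
  split_ifs
  · field_simp
  · ring

theorem killedGenerator_mul (hne : ∀ x, h x ≠ 0) (hharm : ∀ x, killedGenerator rate h x = 0)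
    (f : Chamber n → ℝ) : killedGenerator rate (h * f) = h * doobGenerator rate h f := by
  funext x
  suffices hx : killedGenerator rate (h * f) x - f x * killedGenerator rate h x =
      h x * doobGenerator rate h f x by
    rwa [hharm, mul_zero, sub_zero] at hx
  rw [doobGenerator, jumpGenerator, killedGenerator, killedGenerator, Finset.mul_sum,
    Finset.mul_sum, ← Finset.sum_sub_distrib]
  refine Finset.sum_congr rfl fun i _ => ?_
  have hx := hne x
  rw [doobRate]
  split_ifs
  · simp only [Pi.mul_apply]
    field_simp
    ring
  · simp only [Pi.mul_apply]
    ring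

theorem iterate_killedGenerator_mul (hne : ∀ x, h x ≠ 0)
    (hharm : ∀ x, killedGenerator rate h x = 0) (m : ℕ) (f : Chamber n → ℝ) :
    (killedGenerator rate)^[m] (h * f) = h * (doobGenerator rate h)^[m] f := by
  induction m with
  | zero => rfl
  | succ m ih =>
    rw [Function.iterate_succ_apply', ih, killedGenerator_mul hne hharm,
      Function.iterate_succ_apply']

theorem iterate_killedGenerator_smul (c : ℝ) (m : ℕ) (f : Chamber n → ℝ) :
    (killedGenerator rate)^[m] (c • f) = c • (killedGenerator rate)^[m] f := by
  induction m with
  | zero => rfl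
  | succ m ih =>
    funext x
    rw [Function.iterate_succ_apply', ih, Function.iterate_succ_apply', Pi.smul_apply,
      killedGenerator, killedGenerator, smul_eq_mul, Finset.mul_sum]
    refine Finset.sum_congr rfl fun i _ => ?_
    split_ifs <;> simp only [Pi.smul_apply, smul_eq_mul] <;> ring

theorem iterate_doobGenerator_indicator (hne : ∀ x, h x ≠ 0)
    (hharm : ∀ x, killedGenerator rate h x = 0) (m : ℕ) (x y : Chamber n) :
    (doobGenerator rate h)^[m] (Set.indicator {y} 1) x =
      h y / h x * (killedGenerator rate)^[m] (Set.indicator {y} 1) x := by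
  have hind : h * Set.indicator {y} 1 = h y • Set.indicator {y} 1 := by
    funext x
    by_cases hx : x = y <;> simp [hx]
  have hiter := congrFun (iterate_killedGenerator_mul hne hharm m (Set.indicator {y} 1)) x
  rw [hind, iterate_killedGenerator_smul, Pi.smul_apply, Pi.mul_apply, smul_eq_mul] at hiter
  rw [div_mul_eq_mul_div, hiter, mul_div_cancel_left₀ _ (hne x)]

theorem expKernel_doobGenerator {M : ℝ} (hM : ∀ a, |rate a| ≤ M) (hne : ∀ x, h x ≠ 0)
    (hharm : ∀ x, killedGenerator rate h x = 0) (t : ℝ) (x y : Chamber n) :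
    expKernel (doobGenerator rate h) t x y = h y / h x * karlinMcGregor rate t x y := by
  rw [← (hasSum_karlinMcGregor hM t x y).tsum_eq, expKernel, ← tsum_mul_left]
  simp only [iterate_doobGenerator_indicator hne hharm, mul_left_comm]

end DoobTransform

/-! ### Reversing the push-block mechanism -/

section Reverse

variable {N : ℕ}

theorem Particle.ext_val {p q : Particle N} (hlevel : (p.1 : ℕ) = q.1)
    (hindex : (p.2 : ℕ) = q.2) : p = q := by
  obtain ⟨⟨k, hk⟩, ⟨i, hi⟩⟩ := p
  obtain ⟨⟨l, hl⟩, ⟨j, hj⟩⟩ := q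
  dsimp at hlevel hindex
  subst hlevel hindex
  rfl

theorem GT.ext_pos {x y : GT N} (h : ∀ p, x.pos p = y.pos p) : x = y :=
  GT.ext (funext fun k => Chamber.ext (funext fun i => h ⟨k, i⟩))

theorem Particle.NextIndexAbove.left_unique {p p' q : Particle N} (h : p.NextIndexAbove q)
    (h' : p'.NextIndexAbove q) : p = p' :=
  Particle.ext_val (by have := h.1; have := h'.1; omega) (by have := h.2; have := h'.2; omega)

theorem Particle.NextIndexAbove.right_unique {p q q' : Particle N} (h : p.NextIndexAbove q)
    (h' : p.NextIndexAbove q') : q = q' :=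
  Particle.ext_val (by have := h.1; have := h'.1; omega) (by have := h.2; have := h'.2; omega)

theorem Particle.SameIndexAbove.left_unique {p p' q : Particle N} (h : p.SameIndexAbove q)
    (h' : p'.SameIndexAbove q) : p = p' :=
  Particle.ext_val (by have := h.1; have := h'.1; omega) (by have := h.2; have := h'.2; omega)

theorem Particle.SameIndexAbove.right_unique {p q q' : Particle N} (h : p.SameIndexAbove q)
    (h' : p.SameIndexAbove q') : q = q' :=
  Particle.ext_val (by have := h.1; have := h'.1; omega) (by have := h.2; have := h'.2; omega)

theorem Particle.exists_sameIndexAbove {p : Particle N} (h : (p.1 : ℕ) + 1 < N) :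
    ∃ q : Particle N, p.SameIndexAbove q :=
  ⟨⟨⟨p.1 + 1, h⟩, ⟨p.2, by have := p.2.2; dsimp; omega⟩⟩, rfl, rfl⟩

/-- `q` pushes `q'` when it moves to the right by one. -/
def Pushes (x : GT N) (q q' : Particle N) : Prop :=
  q.NextIndexAbove q' ∧ ¬ (x.pos q + 1 < x.pos q')

theorem Pushes.right_unique (x : GT N) : Relator.RightUnique (Pushes x) :=
  fun _ _ _ h h' => h.1.right_unique h'.1

theorem Pushes.pos_add_one {x : GT N} {q q' : Particle N} (h : Pushes x q q') :
    x.pos q + 1 = x.pos q' := by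
  have := x.pos_lt h.1
  have := h.2
  omega

theorem moves_iff_reflTransGen {x : GT N} {p q : Particle N} :
    Moves x p q ↔ Relation.ReflTransGen (Pushes x) p q := by
  constructor
  · intro h
    induction h with
    | self => exact Relation.ReflTransGen.refl
    | push r r' _ hn hb ih => exact ih.tail ⟨hn, hb⟩
  · intro h
    induction h with
    | refl => exact Moves.self
    | tail _ h ih => exact Moves.push _ _ ih h.1 h.2

theorem Moves.level_le {x : GT N} {p q : Particle N} (h : Moves x p q) : (p.1 : ℕ) ≤ q.1 := by
  induction h with
  | self => exact le_rfl
  | push r r' _ hn _ ih =>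
    have := hn.1
    omega

theorem GT.pos_jump_of_moves {x : GT N} {p q : Particle N} (hp : ¬ Blocked x p)
    (h : Moves x p q) : (jump x p hp).pos q = x.pos q + 1 :=
  congrArg (x.pos q + ·) (if_pos h)

theorem GT.pos_jump_of_not_moves {x : GT N} {p q : Particle N} (hp : ¬ Blocked x p)
    (h : ¬ Moves x p q) : (jump x p hp).pos q = x.pos q :=
  congrArg (x.pos q + ·) (if_neg h)

/-- The particle `q` can have been the last one to move: lowering it by one, together with the
particles below it that must then have pushed it, leads to a pattern. -/
structure Lowerable (x : GT N) (q : Particle N) : Prop where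
  one_le : 1 ≤ x.pos q
  add_one_lt : ∀ j, j < q.2 → x.pos ⟨q.1, j⟩ + 1 < x.pos q
  above : ∀ r, q.SameIndexAbove r → x.pos r < x.pos q

theorem Lowerable.of_above {x : GT N} {q r : Particle N} (hr : q.SameIndexAbove r)
    (h : x.pos r < x.pos q) : Lowerable x q := by
  refine ⟨by omega, fun j hj => ?_, fun s hs => hr.right_unique hs ▸ h⟩
  obtain ⟨⟨k, hk⟩, ⟨i, hi⟩⟩ := q
  obtain ⟨⟨l, hl⟩, ⟨i', hi'⟩⟩ := r
  obtain ⟨j, hj'⟩ := j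
  obtain ⟨hlevel, hindex⟩ := hr
  dsimp at hlevel hindex hj'
  subst hlevel hindex
  have hj : j < i' := hj
  have hnext := x.pos_lt (q := ⟨⟨k, hk⟩, ⟨j, hj'⟩⟩)
    (p := ⟨⟨k + 1, hl⟩, ⟨j + 1, by dsimp; omega⟩⟩) ⟨rfl, rfl⟩
  have hmono : x.pos ⟨⟨k + 1, hl⟩, ⟨j + 1, by dsimp; omega⟩⟩ ≤ x.pos ⟨⟨k + 1, hl⟩, ⟨i', hi'⟩⟩ :=
    (x.level ⟨k + 1, hl⟩).strictMono.monotone (by simp only [Fin.mk_le_mk]; omega)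
  dsimp only
  omega

/-- If `r` has just moved, then `q` pushed it: after the move, `q` is still adjacent to `r`. -/
def DownStep (x : GT N) (r q : Particle N) : Prop :=
  q.NextIndexAbove r ∧ x.pos q + 1 = x.pos r

/-- `PushChain x q r`: the particle `r` must have moved if `q` was the last one to move. -/
def PushChain (x : GT N) : Particle N → Particle N → Prop := Relation.ReflTransGen (DownStep x)

theorem PushChain.refl (x : GT N) (q : Particle N) : PushChain x q q := Relation.ReflTransGen.refl

theorem DownStep.right_unique (x : GT N) : Relator.RightUnique (DownStep x) :=
  fun _ _ _ h h' => h.1.left_unique h'.1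

theorem PushChain.level_le {x : GT N} {q r : Particle N} (h : PushChain x q r) :
    (r.1 : ℕ) ≤ q.1 := by
  induction h with
  | refl => exact le_rfl
  | tail _ h ih =>
    have := h.1.1
    omega

theorem PushChain.antisymm {x : GT N} {q r : Particle N} (h : PushChain x q r)
    (hle : (q.1 : ℕ) ≤ r.1) : q = r := by
  rcases Relation.ReflTransGen.cases_head h with h | ⟨s, hqs, hsr⟩
  · exact h
  · have := PushChain.level_le hsr
    have := hqs.1.1
    omega

theorem Lowerable.downStep {x : GT N} {q r : Particle N} (hq : Lowerable x q)
    (h : DownStep x q r) : Lowerable x r := by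
  obtain ⟨⟨hlevel, hindex⟩, hpos⟩ := h
  have hr_lt : (r.2 : ℕ) < q.1 + 1 := by have := q.2.2; omega
  obtain ⟨s, hs⟩ := Particle.exists_sameIndexAbove (p := r) (by have := q.1.2; omega)
  have hsq : s = ⟨q.1, ⟨r.2, hr_lt⟩⟩ := Particle.ext_val (by rw [hs.1, hlevel]) hs.2
  have := hq.add_one_lt ⟨r.2, hr_lt⟩ (by rw [Fin.lt_def]; dsimp; omega)
  exact Lowerable.of_above hs (by rw [hsq]; omega)

theorem Lowerable.pushChain {x : GT N} {q r : Particle N} (hq : Lowerable x q)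
    (h : PushChain x q r) : Lowerable x r := by
  induction h with
  | refl => exact hq
  | tail _ h ih => exact ih.downStep h

open Classical in
/-- The position of `r` before the move of the particles that must have moved if `q` was the last
one to move. The subtraction is not truncated when `q` is lowerable. -/
def loweredPos (x : GT N) (q r : Particle N) : ℕ :=
  x.pos r - if PushChain x q r then 1 else 0

theorem loweredPos_le (x : GT N) (q r : Particle N) : loweredPos x q r ≤ x.pos r :=
  Nat.sub_le _ _

theorem loweredPos_add_one {x : GT N} {q r : Particle N} (hq : Lowerable x q)
    (h : PushChain x q r) : loweredPos x q r + 1 = x.pos r := by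
  have := (hq.pushChain h).one_le
  rw [loweredPos, if_pos h]
  omega

theorem loweredPos_of_not_pushChain {x : GT N} {q r : Particle N} (h : ¬ PushChain x q r) :
    loweredPos x q r = x.pos r := by
  rw [loweredPos, if_neg h, Nat.sub_zero]

theorem strictMono_loweredPos {x : GT N} {q : Particle N} (hq : Lowerable x q) (k : Fin N) :
    StrictMono fun i => loweredPos x q ⟨k, i⟩ := by
  intro i j hij
  have hpos : x.pos ⟨k, i⟩ < x.pos ⟨k, j⟩ := (x.level k).strictMono hij
  have := loweredPos_le x q ⟨k, i⟩
  dsimp only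
  by_cases h : PushChain x q ⟨k, j⟩
  · have : x.pos ⟨k, i⟩ + 1 < x.pos ⟨k, j⟩ := (hq.pushChain h).add_one_lt i hij
    have := loweredPos_add_one hq h
    omega
  · rw [loweredPos_of_not_pushChain h]
    omega

theorem loweredPos_le_of_sameIndexAbove {x : GT N} {q r s : Particle N} (hq : Lowerable x q)
    (hrs : r.SameIndexAbove s) : loweredPos x q s ≤ loweredPos x q r := by
  have := x.pos_le hrs
  have := loweredPos_le x q s
  by_cases h : PushChain x q r
  · have := (hq.pushChain h).above s hrs
    have := loweredPos_add_one hq h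
    omega
  · rw [loweredPos_of_not_pushChain h]
    omega

theorem loweredPos_lt_of_nextIndexAbove {x : GT N} {q r s : Particle N} (hq : Lowerable x q)
    (hrs : r.NextIndexAbove s) : loweredPos x q r < loweredPos x q s := by
  have := x.pos_lt hrs
  have := loweredPos_le x q r
  by_cases hs : PushChain x q s
  · have := loweredPos_add_one hq hs
    by_cases hadj : x.pos r + 1 = x.pos s
    · have := loweredPos_add_one hq (Relation.ReflTransGen.tail hs ⟨hrs, hadj⟩)
      omega
    · omega
  · rw [loweredPos_of_not_pushChain hs]
    omega

/-- The pattern before the move of `q` and of the particles that must have moved with it. -/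
def pull (x : GT N) (q : Particle N) (hq : Lowerable x q) : GT N where
  level k := ⟨fun i => loweredPos x q ⟨k, i⟩, strictMono_loweredPos hq k⟩
  interlaces _ _ _ :=
    ⟨loweredPos_le_of_sameIndexAbove hq ⟨rfl, rfl⟩, loweredPos_lt_of_nextIndexAbove hq ⟨rfl, rfl⟩⟩

theorem pos_pull_add_one {x : GT N} {q r : Particle N} (hq : Lowerable x q)
    (h : PushChain x q r) : (pull x q hq).pos r + 1 = x.pos r :=
  loweredPos_add_one hq h

theorem pos_pull_of_not {x : GT N} {q r : Particle N} (hq : Lowerable x q)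
    (h : ¬ PushChain x q r) : (pull x q hq).pos r = x.pos r :=
  loweredPos_of_not_pushChain h

theorem exists_chainStart (x : GT N) (q : Particle N) :
    ∃ p, PushChain x q p ∧ ∀ r, ¬ DownStep x p r := by
  have : Nonempty {r // PushChain x q r} := ⟨⟨q, PushChain.refl x q⟩⟩
  obtain ⟨⟨p, hp⟩, hmin⟩ := Finite.exists_min fun r : {r // PushChain x q r} => (r.1.1 : ℕ)
  refine ⟨p, hp, fun r hr => ?_⟩
  have hle : (p.1 : ℕ) ≤ r.1 := hmin ⟨r, hp.tail hr⟩
  have := hr.1.1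
  omega

/-- The particle whose clock must have rung if `q` was the last one to move. -/
def chainStart (x : GT N) (q : Particle N) : Particle N := (exists_chainStart x q).choose

theorem pushChain_chainStart (x : GT N) (q : Particle N) : PushChain x q (chainStart x q) :=
  (exists_chainStart x q).choose_spec.1

theorem not_downStep_chainStart (x : GT N) (q r : Particle N) : ¬ DownStep x (chainStart x q) r :=
  (exists_chainStart x q).choose_spec.2 r

theorem PushChain.to_chainStart {x : GT N} {q r : Particle N} (h : PushChain x q r) :
    PushChain x r (chainStart x q) := by
  rcases Relation.ReflTransGen.total_of_right_unique (DownStep.right_unique x) h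
    (pushChain_chainStart x q) with hr | hr
  · exact hr
  · rcases Relation.ReflTransGen.cases_head hr with heq | ⟨s, hs, -⟩
    · exact heq ▸ PushChain.refl x _
    · exact absurd hs (not_downStep_chainStart x q s)

theorem not_blocked_pull {x : GT N} {q : Particle N} (hq : Lowerable x q) :
    ¬ Blocked (pull x q hq) (chainStart x q) := by
  rintro ⟨r, hr, hpos⟩
  have hstart := pos_pull_add_one hq (pushChain_chainStart x q)
  have := x.pos_le hr
  by_cases h : PushChain x q r
  · have := pos_pull_add_one hq h
    have := (hq.pushChain h).above _ hr
    omega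
  · have := pos_pull_of_not hq h
    omega

theorem moves_pull_iff {x : GT N} {q : Particle N} (hq : Lowerable x q) (r : Particle N) :
    Moves (pull x q hq) (chainStart x q) r ↔ PushChain x q r := by
  constructor
  · intro h
    induction h with
    | self => exact pushChain_chainStart x q
    | push r r' _ hn hb hr =>
      by_contra hr'
      have := pos_pull_of_not hq hr'
      have := pos_pull_add_one hq hr
      have := x.pos_lt hn
      omega
  · intro h
    have hstart := h.to_chainStart
    induction hstart using Relation.ReflTransGen.head_induction_on with
    | refl => exact Moves.self
    | head hstep _ ih =>
      have hr' := h.tail hstep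
      refine Moves.push _ _ (ih hr') hstep.1 ?_
      have := pos_pull_add_one hq h
      have := pos_pull_add_one hq hr'
      have := hstep.2
      omega

theorem jump_pull {x : GT N} {q : Particle N} (hq : Lowerable x q) :
    jump (pull x q hq) (chainStart x q) (not_blocked_pull hq) = x := by
  refine GT.ext_pos fun r => ?_
  by_cases h : PushChain x q r
  · rw [GT.pos_jump_of_moves _ ((moves_pull_iff hq r).2 h), pos_pull_add_one hq h]
  · rw [GT.pos_jump_of_not_moves _ (mt (moves_pull_iff hq r).1 h), pos_pull_of_not hq h]

theorem Moves.lowerable_jump {w : GT N} {p q : Particle N} (hp : ¬ Blocked w p)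
    (hq : Moves w p q) : Lowerable (jump w p hp) q := by
  have hpos := GT.pos_jump_of_moves hp hq
  refine ⟨by omega, fun j hj => ?_, fun r hr => ?_⟩
  · have hlt : w.pos ⟨q.1, j⟩ < w.pos q := (w.level q.1).strictMono hj
    by_cases hmove : Moves w p ⟨q.1, j⟩
    · have hgap : w.pos ⟨q.1, j⟩ + 1 < w.pos q :=
        w.add_one_lt_of_below (j := q.2) hj (hmove.add_one_le hp)
      have := GT.pos_jump_of_moves hp hmove
      omega
    · have := GT.pos_jump_of_not_moves hp hmove
      omega
  · have := w.pos_le hr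
    by_cases hmove : Moves w p r
    · have := hmove.add_one_le hp q hr
      have := GT.pos_jump_of_moves hp hmove
      omega
    · have := GT.pos_jump_of_not_moves hp hmove
      omega

theorem exists_moves_last (w : GT N) (p : Particle N) :
    ∃ q, Moves w p q ∧ ∀ r, ¬ Pushes w q r := by
  have : Nonempty {r // Moves w p r} := ⟨⟨p, Moves.self⟩⟩
  obtain ⟨⟨q, hq⟩, hmax⟩ := Finite.exists_max fun r : {r // Moves w p r} => (r.1.1 : ℕ)
  refine ⟨q, hq, fun r hr => ?_⟩
  have hle : (r.1 : ℕ) ≤ q.1 := hmax ⟨r, Moves.push _ _ hq hr.1 hr.2⟩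
  have := hr.1.1
  omega

theorem Moves.pushChain_jump {w : GT N} {p q r : Particle N} (hp : ¬ Blocked w p)
    (hr : Moves w p r) (hrq : Relation.ReflTransGen (Pushes w) r q) :
    PushChain (jump w p hp) q r := by
  induction hrq using Relation.ReflTransGen.head_induction_on with
  | refl => exact PushChain.refl _ _
  | head hpush _ ih =>
    have hr' := Moves.push _ _ hr hpush.1 hpush.2
    refine (ih hr').tail ⟨hpush.1, ?_⟩
    rw [GT.pos_jump_of_moves hp hr, GT.pos_jump_of_moves hp hr', hpush.pos_add_one]

theorem pushChain_jump_iff {w : GT N} {p q : Particle N} (hp : ¬ Blocked w p)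
    (hq : Moves w p q) (hlast : ∀ r, ¬ Pushes w q r) (r : Particle N) :
    PushChain (jump w p hp) q r ↔ Moves w p r := by
  constructor
  · intro h
    induction h with
    | refl => exact hq
    | tail _ hstep hr =>
      by_contra hr'
      have hadj := hstep.2
      rw [GT.pos_jump_of_moves hp hr, GT.pos_jump_of_not_moves hp hr'] at hadj
      have := w.pos_lt hstep.1
      omega
  · intro hr
    rcases Relation.ReflTransGen.total_of_right_unique (Pushes.right_unique w)
      (moves_iff_reflTransGen.1 hr) (moves_iff_reflTransGen.1 hq) with hrq | hqr
    · exact hr.pushChain_jump hp hrq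
    · rcases Relation.ReflTransGen.cases_head hqr with heq | ⟨s, hs, -⟩
      · exact heq ▸ PushChain.refl _ _
      · exact absurd hs (hlast s)

theorem exists_pull_eq {w : GT N} {p : Particle N} (hp : ¬ Blocked w p) :
    ∃ (q : Particle N) (hq : Lowerable (jump w p hp) q),
      pull (jump w p hp) q hq = w ∧ chainStart (jump w p hp) q = p := by
  obtain ⟨q, hq, hlast⟩ := exists_moves_last w p
  have hchain := pushChain_jump_iff hp hq hlast
  refine ⟨q, hq.lowerable_jump hp, GT.ext_pos fun r => ?_, ?_⟩
  · by_cases hr : Moves w p r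
    · have := pos_pull_add_one (hq.lowerable_jump hp) ((hchain r).2 hr)
      rw [GT.pos_jump_of_moves hp hr] at this
      omega
    · rw [pos_pull_of_not _ (mt (hchain r).1 hr), GT.pos_jump_of_not_moves hp hr]
  · have hstart := ((hchain p).2 Moves.self).to_chainStart
    exact (hstart.antisymm ((hchain _).1 (pushChain_chainStart _ q)).level_le).symm

theorem pull_injective {x : GT N} {q q' : Particle N} (hq : Lowerable x q) (hq' : Lowerable x q')
    (hpull : pull x q hq = pull x q' hq') : q = q' := by
  have hchain (r : Particle N) : PushChain x q r ↔ PushChain x q' r := by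
    have hpos : (pull x q hq).pos r = (pull x q' hq').pos r := by rw [hpull]
    constructor <;> intro h <;> by_contra h'
    · have := pos_pull_add_one hq h
      have := pos_pull_of_not hq' h'
      omega
    · have := pos_pull_add_one hq' h
      have := pos_pull_of_not hq h'
      omega
  exact ((hchain q').2 (PushChain.refl x q')).antisymm
    ((hchain q).1 (PushChain.refl x q)).level_le

/-- Unblocked jumps that lead to `x` correspond to the particles of `x` that can be lowered, through
the last particle that moves. -/
def pullEquiv (x : GT N) : {q // Lowerable x q} ≃
    {wp : GT N × Particle N // ∃ hp : ¬ Blocked wp.1 wp.2, jump wp.1 wp.2 hp = x} :=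
  Equiv.ofBijective
    (fun q => ⟨(pull x q.1 q.2, chainStart x q.1), not_blocked_pull q.2, jump_pull q.2⟩) <| by
    constructor
    · rintro ⟨q, hq⟩ ⟨q', hq'⟩ h
      simp only [Subtype.mk.injEq, Prod.mk.injEq] at h
      exact Subtype.ext (pull_injective hq hq' h.1)
    · rintro ⟨⟨w, p⟩, hp, rfl⟩
      obtain ⟨q, hq, hpull, hstart⟩ := exists_pull_eq hp
      exact ⟨⟨q, hq⟩, Subtype.ext (Prod.ext hpull hstart)⟩

end Reverse

/-! ### Reversed moves and the weights of patterns -/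

section Weight

variable {N : ℕ}

/-- The configuration on the top level of a pattern. -/
def GT.top (x : GT (N + 1)) : Chamber (N + 1) := x.level (Fin.last N)

/-- The particles of the top level. -/
def topParticle (i : Fin (N + 1)) : Particle (N + 1) := ⟨Fin.last N, i⟩

@[simp]
theorem GT.pos_topParticle (x : GT (N + 1)) (i : Fin (N + 1)) :
    x.pos (topParticle i) = x.top.pos i := rfl

theorem topParticle_injective : Function.Injective (topParticle (N := N)) :=
  fun _ _ h => eq_of_heq (Sigma.mk.inj h).2

theorem not_sameIndexAbove_topParticle {i : Fin (N + 1)} {r : Particle (N + 1)} :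
    ¬ (topParticle i).SameIndexAbove r := fun h => by
  have hlevel : (r.1 : ℕ) = N + 1 := h.1
  omega

theorem sum_below_add_sum_topParticle (f : Particle (N + 1) → ℝ) :
    ∑ q : Particle (N + 1) with (q.1 : ℕ) < N, f q + ∑ i, f (topParticle i) = ∑ q, f q := by
  rw [Finset.sum_filter, Fintype.sum_sigma, Fintype.sum_sigma, Fin.sum_univ_castSucc,
    Fin.sum_univ_castSucc (n := N) fun k => ∑ i, f ⟨k, i⟩]
  simp [topParticle]

/-- The product of the inverse rates of the particles below the top level. -/
def weight (rate : ℕ → ℝ) (x : GT (N + 1)) : ℝ :=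
  ∏ r : Particle (N + 1) with (r.1 : ℕ) < N, (rate (x.pos r))⁻¹

theorem weight_eq_prod_levels (rate : ℕ → ℝ) (x : GT (N + 1)) :
    weight rate x = ∏ k : Fin N, ∏ i, (rate ((x.level k.castSucc).pos i))⁻¹ := by
  rw [weight, Finset.prod_filter, Fintype.prod_sigma, Fin.prod_univ_castSucc]
  simp only [Fin.val_castSucc, Fin.is_lt, if_true, Fin.val_last, lt_irrefl, if_false,
    Finset.prod_const_one, mul_one]
  rfl

theorem prod_castSucc_div_succ {G₀ : Type*} [CommGroupWithZero G₀] {n : ℕ} (a : Fin (n + 1) → G₀)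
    (ha : ∀ k, a k ≠ 0) : ∏ k : Fin n, a k.castSucc / a k.succ = a 0 / a (Fin.last n) := by
  induction n with
  | zero => exact (div_self (ha 0)).symm
  | succ n ih =>
    rw [Fin.prod_univ_castSucc]
    simp only [Fin.succ_castSucc]
    rw [ih (fun k => a k.castSucc) fun k => ha _, Fin.succ_last, Fin.castSucc_zero,
      div_mul_div_cancel₀ (ha _)]

theorem interlacingKernel_of_interlaces (rate : ℕ → ℝ) {n : ℕ} {x : Chamber (n + 1)}
    {y : Chamber n} (h : Interlaces y x) :
    interlacingKernel rate x y = ∏ i, (rate (y.pos i))⁻¹ := if_pos h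

/- Along a pattern the factors `𝔥ₙ(y) / 𝔥ₙ₊₁(x)` of the kernels telescope. -/
theorem gibbs_eq_mul_weight {rate : ℕ → ℝ}
    (hne : ∀ n (x : Chamber (n + 1)), harmonic rate (n + 1) x ≠ 0)
    (m : Chamber (N + 1) → ℝ) (x : GT (N + 1)) :
    gibbs rate m x = m x.top / harmonic rate (N + 1) x.top * weight rate x := by
  have hkernel (k : Fin N) : levelKernel rate (x.level k.succ) (x.level k.castSucc) =
      harmonic rate ((k.castSucc : Fin (N + 1)) + 1) (x.level k.castSucc) /
        harmonic rate ((k.succ : Fin (N + 1)) + 1) (x.level k.succ) *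
          ∏ i, (rate ((x.level k.castSucc).pos i))⁻¹ :=
    congrArg _ (interlacingKernel_of_interlaces rate (x.interlaces k (Nat.succ_lt_succ k.2)))
  have htelescope := prod_castSucc_div_succ
    (fun k : Fin (N + 1) => harmonic rate (k + 1) (x.level k)) fun k => hne _ _
  have hbottom : harmonic rate (((0 : Fin (N + 1)) : ℕ) + 1) (x.level 0) = 1 := rfl
  rw [gibbs, Finset.prod_congr rfl fun k _ => hkernel k, Finset.prod_mul_distrib, htelescope,
    ← weight_eq_prod_levels, hbottom, one_div, ← mul_assoc, ← div_eq_mul_inv]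
  rfl

open Classical in
/-- The particles that must have moved if `q` was the last one to move. -/
def pushChain (x : GT N) (q : Particle N) : Finset (Particle N) :=
  Finset.univ.filter (PushChain x q)

@[simp]
theorem mem_pushChain {x : GT N} {q r : Particle N} : r ∈ pushChain x q ↔ PushChain x q r := by
  simp only [pushChain, Finset.mem_filter, Finset.mem_univ, true_and]

theorem self_mem_pushChain (x : GT N) (q : Particle N) : q ∈ pushChain x q :=
  mem_pushChain.2 (PushChain.refl x q)

theorem pushChain_eq_singleton {x : GT N} {p : Particle N} (hp : ∀ r, ¬ DownStep x p r) :
    pushChain x p = {p} := by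
  ext r
  rw [mem_pushChain, Finset.mem_singleton]
  constructor
  · intro h
    rcases Relation.ReflTransGen.cases_head h with heq | ⟨s, hs, -⟩
    · exact heq.symm
    · exact absurd hs (hp s)
  · rintro rfl
    exact PushChain.refl x r

theorem pushChain_eq_insert [DecidableEq (Particle N)] {x : GT N} {q q' : Particle N}
    (h : DownStep x q q') : pushChain x q = insert q (pushChain x q') := by
  ext r
  rw [Finset.mem_insert, mem_pushChain, mem_pushChain]
  constructor
  · intro hr
    rcases Relation.ReflTransGen.cases_head hr with heq | ⟨s, hs, hsr⟩
    · exact Or.inl heq.symm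
    · exact Or.inr (DownStep.right_unique x hs h ▸ hsr)
  · rintro (rfl | hr)
    · exact PushChain.refl x r
    · exact Relation.ReflTransGen.head h hr

theorem DownStep.notMem_pushChain {x : GT N} {q q' : Particle N} (h : DownStep x q q') :
    q ∉ pushChain x q' := fun hq => by
  have := (mem_pushChain.1 hq).level_le
  have := h.1.1
  omega

theorem level_lt_of_mem_erase [DecidableEq (Particle N)] {x : GT N} {q r : Particle N}
    (h : r ∈ (pushChain x q).erase q) : (r.1 : ℕ) < q.1 := by
  rw [Finset.mem_erase, mem_pushChain] at h
  exact lt_of_not_ge fun hle => h.1 (h.2.antisymm hle).symm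

/- Consecutive particles of a chain are adjacent, so that each particle of the chain came from the
present position of the next one. -/
theorem rate_mul_prod_erase_pushChain [DecidableEq (Particle N)] (rate : ℕ → ℝ) {x : GT N}
    {p q : Particle N} (h : PushChain x q p) (hp : ∀ r, ¬ DownStep x p r) :
    rate (x.pos p - 1) * ∏ r ∈ (pushChain x q).erase q, rate (x.pos r) =
      ∏ r ∈ pushChain x q, rate (x.pos r - 1) := by
  induction h using Relation.ReflTransGen.head_induction_on with
  | refl => simp [pushChain_eq_singleton hp]
  | @head q q' hstep _ ih =>
    rw [pushChain_eq_insert hstep, Finset.erase_insert hstep.notMem_pushChain,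
      Finset.prod_insert hstep.notMem_pushChain, ← ih,
      ← Finset.mul_prod_erase _ _ (self_mem_pushChain x q'), ← hstep.2, Nat.add_sub_cancel]
    ring

theorem weight_pull_mul_prod {rate : ℕ → ℝ} (hrate : ∀ a, rate a ≠ 0) {x : GT (N + 1)}
    {q : Particle (N + 1)} (hq : Lowerable x q) :
    weight rate (pull x q hq) * ∏ r ∈ pushChain x q with (r.1 : ℕ) < N, rate (x.pos r - 1) =
      weight rate x * ∏ r ∈ pushChain x q with (r.1 : ℕ) < N, rate (x.pos r) := by
  classical
  rw [pushChain, Finset.filter_comm, Finset.prod_filter (PushChain x q),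
    Finset.prod_filter (PushChain x q), weight, weight,
    ← Finset.prod_mul_distrib, ← Finset.prod_mul_distrib]
  refine Finset.prod_congr rfl fun r _ => ?_
  by_cases hr : PushChain x q r
  · rw [if_pos hr, if_pos hr, ← pos_pull_add_one hq hr, Nat.add_sub_cancel,
      inv_mul_cancel₀ (hrate _), inv_mul_cancel₀ (hrate _)]
  · rw [if_neg hr, if_neg hr, pos_pull_of_not hq hr]

theorem rate_pull_chainStart_mul_prod [DecidableEq (Particle N)] (rate : ℕ → ℝ) {x : GT N}
    {q : Particle N} (hq : Lowerable x q) :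
    rate ((pull x q hq).pos (chainStart x q)) * ∏ r ∈ (pushChain x q).erase q, rate (x.pos r) =
      ∏ r ∈ pushChain x q, rate (x.pos r - 1) := by
  rw [← rate_mul_prod_erase_pushChain rate (pushChain_chainStart x q)
    (not_downStep_chainStart x q), ← pos_pull_add_one hq (pushChain_chainStart x q),
    Nat.add_sub_cancel]

theorem prod_erase_pushChain_ne_zero [DecidableEq (Particle N)] {rate : ℕ → ℝ}
    (hrate : ∀ a, rate a ≠ 0) (x : GT N) (q : Particle N) :
    ∏ r ∈ (pushChain x q).erase q, rate (x.pos r) ≠ 0 :=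
  Finset.prod_ne_zero_iff.2 fun _ _ => hrate _

theorem weight_pull_mul_rate_of_lt {rate : ℕ → ℝ} (hrate : ∀ a, rate a ≠ 0) {x : GT (N + 1)}
    {q : Particle (N + 1)} (hq : Lowerable x q) (h : (q.1 : ℕ) < N) :
    weight rate (pull x q hq) * rate ((pull x q hq).pos (chainStart x q)) =
      weight rate x * rate (x.pos q) := by
  classical
  have hweight := weight_pull_mul_prod hrate hq
  rw [Finset.filter_true_of_mem fun r hr => (mem_pushChain.1 hr).level_le.trans_lt h,
    ← rate_pull_chainStart_mul_prod rate hq,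
    ← Finset.mul_prod_erase _ _ (self_mem_pushChain x q)] at hweight
  refine mul_right_cancel₀ (prod_erase_pushChain_ne_zero hrate x q) ?_
  linear_combination hweight

theorem weight_pull_mul_rate_topParticle {rate : ℕ → ℝ} (hrate : ∀ a, rate a ≠ 0)
    {x : GT (N + 1)} {i : Fin (N + 1)} (hq : Lowerable x (topParticle i)) :
    weight rate (pull x _ hq) * rate ((pull x _ hq).pos (chainStart x (topParticle i))) =
      weight rate x * rate (x.top.pos i - 1) := by
  classical
  have hbelow : (pushChain x (topParticle i)).filter (fun r => (r.1 : ℕ) < N) =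
      (pushChain x (topParticle i)).erase (topParticle i) := by
    ext r
    refine ⟨fun hr => ?_, fun hr => Finset.mem_filter.2
      ⟨Finset.mem_of_mem_erase hr, level_lt_of_mem_erase hr⟩⟩
    rw [Finset.mem_filter] at hr
    refine Finset.mem_erase.2 ⟨?_, hr.1⟩
    rintro rfl
    exact lt_irrefl N hr.2
  have hweight := weight_pull_mul_prod hrate hq
  have hrates := rate_pull_chainStart_mul_prod rate hq
  rw [hbelow] at hweight
  rw [← Finset.mul_prod_erase _ _ (self_mem_pushChain x (topParticle i)),
    GT.pos_topParticle] at hrates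
  refine mul_right_cancel₀ (prod_erase_pushChain_ne_zero hrate x (topParticle i)) ?_
  linear_combination rate (x.top.pos i - 1) * hweight + weight rate (pull x _ hq) * hrates

open Classical in
theorem sum_blocked_eq (rate : ℕ → ℝ) (x : GT (N + 1)) :
    ∑ p with Blocked x p, rate (x.pos p) =
      ∑ q : Particle (N + 1) with (q.1 : ℕ) < N ∧ ¬ Lowerable x q, rate (x.pos q) := by
  have hblocked {p} (hp : p ∈ Finset.univ.filter (Blocked x)) := (Finset.mem_filter.1 hp).2
  refine Finset.sum_bij (fun p hp => (hblocked hp).choose) (fun p hp => ?_)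
    (fun p hp p' hp' h => ?_) (fun q hq => ?_) (fun p hp => ?_)
  · obtain ⟨habove, hpos⟩ := (hblocked hp).choose_spec
    simp only [Finset.mem_filter, Finset.mem_univ, true_and]
    refine ⟨?_, fun hl => ?_⟩
    · have := habove.1
      have := p.1.2
      omega
    · have := hl.above p habove
      omega
  · exact (hblocked hp).choose_spec.1.right_unique (h ▸ (hblocked hp').choose_spec.1)
  · simp only [Finset.mem_filter, Finset.mem_univ, true_and] at hq
    obtain ⟨p, hp⟩ := Particle.exists_sameIndexAbove (p := q) (by omega)
    have hpos : x.pos q = x.pos p := by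
      have := x.pos_le hp
      by_contra hne
      exact hq.2 (Lowerable.of_above hp (by omega))
    have hmem : p ∈ Finset.univ.filter (Blocked x) :=
      Finset.mem_filter.2 ⟨Finset.mem_univ p, q, hp, hpos⟩
    exact ⟨p, hmem, (hblocked hmem).choose_spec.1.left_unique hp⟩
  · rw [(hblocked hp).choose_spec.2]

open Classical in
theorem sum_not_blocked_eq (rate : ℕ → ℝ) (x : GT (N + 1)) :
    ∑ p with ¬ Blocked x p, rate (x.pos p) =
      ∑ q : Particle (N + 1) with (q.1 : ℕ) < N ∧ Lowerable x q, rate (x.pos q) +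
        ∑ i, rate (x.top.pos i) := by
  have hall := sum_below_add_sum_topParticle fun q => rate (x.pos q)
  have hsplit := Finset.sum_filter_add_sum_filter_not Finset.univ (Blocked x)
    fun q => rate (x.pos q)
  have hbelow := Finset.sum_filter_add_sum_filter_not
    (Finset.univ.filter fun q : Particle (N + 1) => (q.1 : ℕ) < N) (Lowerable x)
    fun q => rate (x.pos q)
  rw [Finset.filter_filter, Finset.filter_filter, ← sum_blocked_eq] at hbelow
  simp only [GT.pos_topParticle] at hall
  linarith

theorem top_pull_of_lt {x : GT (N + 1)} {q : Particle (N + 1)} (hq : Lowerable x q)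
    (h : (q.1 : ℕ) < N) : (pull x q hq).top = x.top :=
  Chamber.ext (funext fun i => pos_pull_of_not hq (r := topParticle i) fun hchain =>
    h.not_ge hchain.level_le)

theorem pos_top_pull_topParticle {x : GT (N + 1)} {i : Fin (N + 1)}
    (hq : Lowerable x (topParticle i)) :
    (pull x _ hq).top.pos = Function.update x.top.pos i (x.top.pos i - 1) := by
  funext j
  rcases eq_or_ne j i with rfl | hji
  · rw [Function.update_self]
    exact Nat.eq_sub_of_add_eq (pos_pull_add_one hq (PushChain.refl x _))
  · rw [Function.update_of_ne hji]
    exact pos_pull_of_not hq (r := topParticle j) fun hchain =>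
      hji (topParticle_injective (hchain.antisymm le_rfl).symm)

theorem lowerable_topParticle {x : GT (N + 1)} {i : Fin (N + 1)} (hone : 1 ≤ x.top.pos i)
    (hgap : ∀ j < i, x.top.pos j + 1 < x.top.pos i) : Lowerable x (topParticle i) :=
  ⟨hone, hgap, fun _ hr => absurd hr not_sameIndexAbove_topParticle⟩

theorem Chamber.canRaise_and_raise_eq_iff {n : ℕ} {z y : Chamber n} {i : Fin n} :
    z.CanRaise i ∧ z.raise i = y ↔ y.pos = Function.update z.pos i (z.pos i + 1) := by
  constructor
  · rintro ⟨hz, rfl⟩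
    exact Chamber.raise_pos hz
  · intro hy
    have hz : z.CanRaise i := fun j hij => by
      have hlt := y.strictMono hij
      rwa [hy, Function.update_self, Function.update_of_ne hij.ne'] at hlt
    exact ⟨hz, Chamber.ext (by rw [Chamber.raise_pos hz, hy])⟩

theorem top_pull_eq_iff (x : GT (N + 1)) (z : Chamber (N + 1)) (i : Fin (N + 1)) :
    (∃ hq : Lowerable x (topParticle i), (pull x _ hq).top = z) ↔
      z.CanRaise i ∧ z.raise i = x.top := by
  rw [Chamber.canRaise_and_raise_eq_iff]
  constructor
  · rintro ⟨hq, rfl⟩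
    have hone : 1 ≤ x.top.pos i := hq.one_le
    rw [pos_top_pull_topParticle, Function.update_self, Function.update_idem,
      Nat.sub_add_cancel hone, Function.update_eq_self]
  · intro hx
    have hxi : x.top.pos i = z.pos i + 1 := by rw [hx, Function.update_self]
    have hq : Lowerable x (topParticle i) := lowerable_topParticle (by omega) fun j hji => by
      have := z.strictMono hji
      rw [hxi, hx, Function.update_of_ne hji.ne]
      omega
    refine ⟨hq, Chamber.ext ?_⟩
    rw [pos_top_pull_topParticle, hxi, hx, Function.update_idem, Nat.add_sub_cancel,
      Function.update_eq_self]

end Weight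

/-! ### The push-block generator on Gibbs densities -/

section Dual

variable {N : ℕ} {rate : ℕ → ℝ} {M : ℝ}

/-- The push-block generator acting on densities, that is, on summable functions on patterns. It
is the transpose of `pushBlockGenerator` and is bounded because the rates are. -/
def pushBlockDual (N : ℕ) (hM : ∀ a, |rate a| ≤ M) : L1 (GT N) →L[ℝ] L1 (GT N) :=
  jumpDual (fun (p : Particle N) x => rate (x.pos p)) (fun p x => ring x p) M fun _ _ => hM _

open Classical in
theorem pushBlockDual_dirac_apply (hM : ∀ a, |rate a| ≤ M) (w x : GT N) :
    pushBlockDual N hM (L1.dirac w) x =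
      ∑ p, (if ∃ hp : ¬ Blocked w p, jump w p hp = x then rate (w.pos p) else 0) -
        if w = x then ∑ p with ¬ Blocked x p, rate (x.pos p) else 0 := by
  have hout : (if w = x then ∑ p with ¬ Blocked x p, rate (x.pos p) else 0) =
      ∑ p, if w = x ∧ ¬ Blocked w p then rate (w.pos p) else 0 := by
    split_ifs with hwx
    · subst hwx
      simp only [Finset.sum_filter, true_and]
    · simp only [hwx, false_and, if_false, Finset.sum_const_zero]
  rw [pushBlockDual, jumpDual_dirac, L1.sum_apply, hout, ← Finset.sum_sub_distrib]
  refine Finset.sum_congr rfl fun p _ => ?_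
  rw [L1.smul_apply, L1.sub_apply, L1.dirac_apply, L1.dirac_apply, ring]
  by_cases hp : Blocked w p
  · simp [hp]
  · rw [dif_neg hp, if_congr (exists_prop_of_true hp) rfl rfl, if_congr (and_iff_left hp) rfl rfl]
    split_ifs <;> ring

open Classical in
theorem pushBlockDual_apply (hM : ∀ a, |rate a| ≤ M) (ν : L1 (GT N)) (x : GT N) :
    pushBlockDual N hM ν x =
      ∑ q : {q // Lowerable x q},
          ν (pull x q.1 q.2) * rate ((pull x q.1 q.2).pos (chainStart x q.1)) -
        ν x * ∑ p with ¬ Blocked x p, rate (x.pos p) := by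
  refine (L1.hasSum_apply_apply _ ν x).unique ?_
  simp only [pushBlockDual_dirac_apply, mul_sub]
  refine HasSum.sub ?_ ?_
  · let inflow : GT N × Particle N → ℝ := fun wp => ν wp.1 * rate (wp.1.pos wp.2)
    let jumpsTo : Set (GT N × Particle N) :=
      {wp | ∃ hp : ¬ Blocked wp.1 wp.2, jump wp.1 wp.2 hp = x}
    let reversal : {q // Lowerable x q} ≃ jumpsTo := pullEquiv x
    have hpull : HasSum (fun wp : jumpsTo => inflow wp) (∑ q, inflow (reversal q)) :=
      reversal.hasSum_iff.1 (hasSum_fintype fun q => inflow (reversal q))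
    have hinflow : HasSum (jumpsTo.indicator inflow) _ := hasSum_subtype_iff_indicator.1 hpull
    refine hinflow.prod_fiberwise fun w => ?_
    rw [Finset.mul_sum]
    refine (hasSum_fintype _).congr_fun fun p => ?_
    rw [Set.indicator_apply, mul_ite, mul_zero]
    rfl
  · have hout := hasSum_single (f := fun w => ν w * if w = x then
      ∑ p with ¬ Blocked x p, rate (x.pos p) else 0) x fun w hw => by rw [if_neg hw, mul_zero]
    rwa [if_pos rfl] at hout

open Classical in
theorem sum_subtype_eq_sum_dite {ι : Type*} [Fintype ι] {P : ι → Prop} (f : ∀ i, P i → ℝ) :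
    ∑ i : {i // P i}, f i.1 i.2 = ∑ i, if h : P i then f i h else 0 := by
  have hf (i : {i // P i}) : f i.1 i.2 = (fun i => if h : P i then f i h else 0) i.1 :=
    (dif_pos i.2).symm
  rw [Finset.sum_congr rfl fun i _ => hf i, ← Finset.sum_subtype (Finset.univ.filter P) (by simp)
    fun i => if h : P i then f i h else 0, Finset.sum_filter]
  exact Finset.sum_congr rfl fun i _ => by split_ifs <;> rfl

section SingleTop

variable {ν : GT (N + 1) → ℝ} {c : ℝ} {z : Chamber (N + 1)}

open Classical in
theorem apply_pull_mul_rate_of_lt (hrate : ∀ a, rate a ≠ 0)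
    (hν : ∀ x, ν x = if x.top = z then c * weight rate x else 0) {x : GT (N + 1)}
    {q : Particle (N + 1)} (hq : Lowerable x q) (h : (q.1 : ℕ) < N) :
    ν (pull x q hq) * rate ((pull x q hq).pos (chainStart x q)) = ν x * rate (x.pos q) := by
  rw [hν, hν, top_pull_of_lt hq h]
  split_ifs
  · rw [mul_assoc, weight_pull_mul_rate_of_lt hrate hq h, mul_assoc]
  · rw [zero_mul, zero_mul]

open Classical in
theorem dite_apply_pull_mul_rate_topParticle (hrate : ∀ a, rate a ≠ 0)
    (hν : ∀ x, ν x = if x.top = z then c * weight rate x else 0) (x : GT (N + 1))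
    (i : Fin (N + 1)) :
    (if h : Lowerable x (topParticle i) then
        ν (pull x _ h) * rate ((pull x _ h).pos (chainStart x (topParticle i))) else 0) =
      c * weight rate x * if z.CanRaise i ∧ z.raise i = x.top then rate (z.pos i) else 0 := by
  rw [if_congr (top_pull_eq_iff x z i).symm rfl rfl]
  by_cases h : Lowerable x (topParticle i)
  · rw [dif_pos h, hν, if_congr (exists_prop_of_true h) rfl rfl]
    split_ifs with hz
    · have hpos : z.pos i = x.top.pos i - 1 := by
        rw [← hz, pos_top_pull_topParticle, Function.update_self]
      rw [mul_assoc, weight_pull_mul_rate_topParticle hrate h, hpos, mul_assoc]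
    · rw [zero_mul, mul_zero]
  · rw [dif_neg h, if_neg fun ⟨h', _⟩ => h h', mul_zero]

open Classical in
theorem sum_apply_pull_mul_rate (hrate : ∀ a, rate a ≠ 0)
    (hν : ∀ x, ν x = if x.top = z then c * weight rate x else 0) (x : GT (N + 1)) :
    ∑ q : {q // Lowerable x q},
        ν (pull x q.1 q.2) * rate ((pull x q.1 q.2).pos (chainStart x q.1)) =
      ν x * ∑ q : Particle (N + 1) with (q.1 : ℕ) < N ∧ Lowerable x q, rate (x.pos q) +
        c * weight rate x *
          ∑ i, if z.CanRaise i ∧ z.raise i = x.top then rate (z.pos i) else 0 := by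
  rw [sum_subtype_eq_sum_dite fun q h =>
      ν (pull x q h) * rate ((pull x q h).pos (chainStart x q)), ← sum_below_add_sum_topParticle,
    Finset.sum_congr rfl fun i _ => dite_apply_pull_mul_rate_topParticle hrate hν x i,
    ← Finset.mul_sum, ← Finset.filter_filter, Finset.sum_filter (Lowerable x),
    Finset.mul_sum _ _ (ν x), add_left_inj]
  refine Finset.sum_congr rfl fun q hq => ?_
  by_cases h : Lowerable x q
  · rw [dif_pos h, if_pos h, apply_pull_mul_rate_of_lt hrate hν h (Finset.mem_filter.1 hq).2]
  · rw [dif_neg h, if_neg h, mul_zero]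

open Classical in
/- Below the top level the inflow through the lowerable particles balances the outflow through
the unblocked ones, so only the motion of the top level is left. -/
theorem pushBlockDual_apply_of_eq_weight (hrate : ∀ a, rate a ≠ 0) (hM : ∀ a, |rate a| ≤ M)
    {ν : L1 (GT (N + 1))} (hν : ∀ x, ν x = if x.top = z then c * weight rate x else 0)
    (x : GT (N + 1)) :
    pushBlockDual (N + 1) hM ν x =
      c * weight rate x * (∑ i, if z.CanRaise i ∧ z.raise i = x.top then rate (z.pos i) else 0) -
        ν x * ∑ i, rate (x.top.pos i) := by
  rw [pushBlockDual_apply, sum_apply_pull_mul_rate hrate hν, sum_not_blocked_eq]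
  ring

end SingleTop

end Dual

/-! ### The kernels between levels -/

section Levels

variable {rate : ℕ → ℝ}

theorem finite_setOf_interlaces {n : ℕ} (x : Chamber (n + 1)) :
    {y : Chamber n | Interlaces y x}.Finite := by
  have hinj : Set.InjOn Chamber.pos (Chamber.pos ⁻¹' Set.Icc 0 fun i : Fin n => x.pos i.succ) :=
    fun _ _ _ _ h => Chamber.ext h
  exact ((Set.finite_Icc _ _).preimage hinj).subset fun y hy =>
    ⟨fun i => Nat.zero_le _, fun i => (hy i).2.le⟩

theorem interlacingKernel_nonneg (hrate : ∀ a, 0 ≤ rate a) {n : ℕ} (x : Chamber (n + 1))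
    (y : Chamber n) : 0 ≤ interlacingKernel rate x y := by
  rw [interlacingKernel]
  split_ifs
  · exact Finset.prod_nonneg fun i _ => inv_nonneg.2 (hrate _)
  · exact le_rfl

theorem interlacingKernel_of_not_interlaces (rate : ℕ → ℝ) {n : ℕ} {x : Chamber (n + 1)}
    {y : Chamber n} (h : ¬ Interlaces y x) : interlacingKernel rate x y = 0 := if_neg h

theorem levelKernel_of_not_interlaces (rate : ℕ → ℝ) {n : ℕ} {x : Chamber (n + 1)}
    {y : Chamber n} (h : ¬ Interlaces y x) : levelKernel rate x y = 0 := by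
  rw [levelKernel, interlacingKernel_of_not_interlaces rate h, mul_zero]

theorem summable_interlacingKernel_mul {n : ℕ} (x : Chamber (n + 1)) (f : Chamber n → ℝ) :
    Summable fun y => interlacingKernel rate x y * f y := by
  refine summable_of_hasFiniteSupport ((finite_setOf_interlaces x).subset fun y hy => ?_)
  by_contra h
  exact hy (by simp only [interlacingKernel_of_not_interlaces rate h, zero_mul])

theorem exists_interlaces {n : ℕ} (x : Chamber (n + 1)) : ∃ y : Chamber n, Interlaces y x :=
  ⟨⟨fun i => x.pos i.castSucc, fun _ _ h => x.strictMono (Fin.castSucc_lt_castSucc_iff.2 h)⟩,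
    fun _ => ⟨le_rfl, x.strictMono Fin.castSucc_lt_succ⟩⟩

theorem harmonic_pos (hrate : ∀ a, 0 < rate a) (n : ℕ) (x : Chamber (n + 1)) :
    0 < harmonic rate (n + 1) x := by
  induction n with
  | zero => exact one_pos
  | succ n ih =>
    obtain ⟨y, hy⟩ := exists_interlaces x
    rw [harmonic]
    refine (summable_interlacingKernel_mul x _).tsum_pos
      (fun y => mul_nonneg (interlacingKernel_nonneg (fun a => (hrate a).le) x y) (ih y).le) y ?_
    rw [interlacingKernel_of_interlaces rate hy]
    exact mul_pos (Finset.prod_pos fun i _ => inv_pos.2 (hrate _)) (ih y)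

theorem levelKernel_nonneg (hrate : ∀ a, 0 < rate a) {n : ℕ} (x : Chamber (n + 2))
    (y : Chamber (n + 1)) : 0 ≤ levelKernel rate x y :=
  mul_nonneg (div_nonneg (harmonic_pos hrate _ _).le (harmonic_pos hrate _ _).le)
    (interlacingKernel_nonneg (fun a => (hrate a).le) x y)

theorem hasSum_levelKernel (hrate : ∀ a, 0 < rate a) {n : ℕ} (x : Chamber (n + 2)) :
    HasSum (levelKernel rate x) 1 := by
  have hsum : HasSum (fun y => interlacingKernel rate x y * harmonic rate (n + 1) y)
      (harmonic rate (n + 2) x) := by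
    rw [harmonic]
    exact (summable_interlacingKernel_mul x _).hasSum
  have hdiv := hsum.div_const (harmonic rate (n + 2) x)
  rw [div_self (harmonic_pos hrate (n + 1) x).ne'] at hdiv
  refine hdiv.congr_fun fun y => ?_
  rw [levelKernel]
  ring

/-- The kernel `𝔏` from level `n + 2` to level `n + 1` as an operator on densities. -/
def levelOp (hrate : ∀ a, 0 < rate a) (n : ℕ) :
    L1 (Chamber (n + 2)) →L[ℝ] L1 (Chamber (n + 1)) :=
  L1.ofStochastic (levelKernel_nonneg hrate) (hasSum_levelKernel hrate)

end Levels

/-! ### Forgetting the top level -/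

namespace GT

/-- The pattern formed by all the levels below the top one. -/
def dropTop {N : ℕ} (x : GT (N + 1)) : GT N where
  level k := x.level k.castSucc
  interlaces k hk := x.interlaces k (Nat.lt_succ_of_lt hk)

theorem interlaces_top_dropTop {N : ℕ} (x : GT (N + 2)) : Interlaces x.dropTop.top x.top :=
  x.interlaces N (Nat.lt_succ_self _)

theorem ext_dropTop_top {N : ℕ} {x y : GT (N + 1)} (hdrop : x.dropTop = y.dropTop)
    (htop : x.top = y.top) : x = y :=
  GT.ext (funext fun k => Fin.lastCases htop (fun k => congrFun (congrArg level hdrop) k) k)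

theorem exists_dropTop_eq_top_eq {N : ℕ} {x : GT (N + 1)} {z : Chamber (N + 2)}
    (h : Interlaces x.top z) : ∃ y : GT (N + 2), y.dropTop = x ∧ y.top = z := by
  let level : (k : Fin (N + 2)) → Chamber ((k : ℕ) + 1) :=
    Fin.lastCases (motive := fun k : Fin (N + 2) => Chamber ((k : ℕ) + 1)) z fun k => x.level k
  have htop : level (Fin.last (N + 1)) = z := Fin.lastCases_last
  have hlevel (k : Fin (N + 1)) : level k.castSucc = x.level k := Fin.lastCases_castSucc k
  refine ⟨⟨level, fun k hk => ?_⟩, GT.ext (funext hlevel), htop⟩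
  have hlower : level ⟨k, Nat.lt_of_succ_lt hk⟩ = x.level ⟨k, by omega⟩ := hlevel ⟨k, by omega⟩
  rcases Nat.lt_or_ge (k + 1) (N + 1) with hk' | hk'
  · have hupper : level ⟨k + 1, hk⟩ = x.level ⟨k + 1, hk'⟩ := hlevel ⟨k + 1, hk'⟩
    rw [hlower, hupper]
    exact x.interlaces k hk'
  · obtain rfl : k = N := by omega
    have hupper : level ⟨k + 1, hk⟩ = z := htop
    rw [hlower, hupper]
    exact h

theorem exists_top_eq (z : Chamber 1) : ∃ x : GT 1, x.top = z :=
  ⟨⟨Fin.lastCases (motive := fun k : Fin 1 => Chamber ((k : ℕ) + 1)) z fun k => k.elim0,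
    fun _ hk => absurd hk (by omega)⟩, rfl⟩

theorem top_injective_of_one_level : Function.Injective (top : GT 1 → Chamber 1) := fun _ _ h =>
  ext_dropTop_top (GT.ext (funext fun k => k.elim0)) h

end GT

/-! ### Gibbs densities -/

section Gibbs

variable {rate : ℕ → ℝ} {N : ℕ}

theorem gibbs_succ (rate : ℕ → ℝ) (m : Chamber (N + 2) → ℝ) (x : GT (N + 2)) :
    gibbs rate m x = m x.top * gibbs rate (levelKernel rate x.top) x.dropTop := by
  rw [gibbs, gibbs, Fin.prod_univ_castSucc, mul_comm (∏ _, _)]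
  rfl

theorem gibbs_eq_zero (rate : ℕ → ℝ) {m : Chamber (N + 1) → ℝ} {x : GT (N + 1)}
    (h : m x.top = 0) : gibbs rate m x = 0 := mul_eq_zero_of_left h _

theorem gibbs_dirac_of_top_ne (rate : ℕ → ℝ) {z : Chamber (N + 1)} {x : GT (N + 1)}
    (h : x.top ≠ z) : gibbs rate (L1.dirac z) x = 0 :=
  gibbs_eq_zero rate (L1.dirac_ne h.symm)

theorem gibbs_eq_mul_gibbs_dirac_top (rate : ℕ → ℝ) (m : Chamber (N + 1) → ℝ) (x : GT (N + 1)) :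
    gibbs rate m x = m x.top * gibbs rate (L1.dirac x.top) x := by
  have hx : gibbs rate (L1.dirac x.top) x = L1.dirac x.top x.top *
      ∏ k : Fin N, levelKernel rate (x.level k.succ) (x.level k.castSucc) := rfl
  rw [hx, L1.dirac_self, one_mul]
  rfl

theorem gibbs_nonneg (hrate : ∀ a, 0 < rate a) {m : Chamber (N + 1) → ℝ} (hm : ∀ z, 0 ≤ m z)
    (x : GT (N + 1)) : 0 ≤ gibbs rate m x :=
  mul_nonneg (hm _) (Finset.prod_nonneg fun _ _ => levelKernel_nonneg hrate _ _)

theorem L1.ofStochastic_gibbs_dirac_apply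
    (hnonneg : ∀ (z : Chamber (N + 1)) x, 0 ≤ gibbs rate (L1.dirac z) x)
    (hsum : ∀ z : Chamber (N + 1), HasSum (gibbs rate (L1.dirac z)) 1) (m : L1 (Chamber (N + 1)))
    (x : GT (N + 1)) : L1.ofStochastic hnonneg hsum m x = gibbs rate m x := by
  refine (L1.hasSum_apply_apply _ m x).unique ?_
  simp only [L1.ofStochastic_dirac_apply]
  rw [gibbs_eq_mul_gibbs_dirac_top]
  exact hasSum_single x.top fun z hz => by rw [gibbs_dirac_of_top_ne rate hz.symm, mul_zero]

theorem hasSum_gibbs_dirac_zero (rate : ℕ → ℝ) (z : Chamber 1) :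
    HasSum (gibbs rate (L1.dirac z) : GT 1 → ℝ) 1 := by
  obtain ⟨x, rfl⟩ := GT.exists_top_eq z
  have hsingle := hasSum_single (f := gibbs rate (L1.dirac x.top)) x fun y hy =>
    gibbs_dirac_of_top_ne rate fun h => hy (GT.top_injective_of_one_level h)
  have hx : gibbs rate (L1.dirac x.top) x = L1.dirac x.top x.top * 1 := rfl
  rwa [hx, L1.dirac_self, one_mul] at hsingle

theorem hasSum_gibbs_dirac_succ {z : Chamber (N + 2)} {c : ℝ}
    (h : HasSum (gibbs rate (levelKernel rate z)) c) :
    HasSum (gibbs rate (L1.dirac z) : GT (N + 2) → ℝ) c := by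
  let drop : {x : GT (N + 2) | x.top = z} → GT (N + 1) := fun x => x.1.dropTop
  have hinj : Function.Injective drop := fun x y hxy =>
    Subtype.ext (GT.ext_dropTop_top hxy (x.2.trans y.2.symm))
  have hdrop : HasSum (gibbs rate (levelKernel rate z) ∘ drop) c := by
    refine (hinj.hasSum_iff fun x hx => ?_).2 h
    refine gibbs_eq_zero rate (levelKernel_of_not_interlaces rate fun hxz => hx ?_)
    obtain ⟨y, rfl, hy⟩ := GT.exists_dropTop_eq_top_eq hxz
    exact ⟨⟨y, hy⟩, rfl⟩
  refine (hasSum_subtype_iff_of_support_subset fun x hx => ?_).1 (hdrop.congr_fun fun x => ?_)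
  · by_contra hne
    exact hx (gibbs_dirac_of_top_ne rate hne)
  · obtain ⟨x, rfl⟩ := x
    rw [Function.comp_apply, Function.comp_apply, gibbs_succ, L1.dirac_self, one_mul]

theorem hasSum_gibbs_dirac (hrate : ∀ a, 0 < rate a) (N : ℕ) (z : Chamber (N + 1)) :
    HasSum (gibbs rate (L1.dirac z)) 1 := by
  induction N with
  | zero => exact hasSum_gibbs_dirac_zero rate z
  | succ N ih =>
    refine hasSum_gibbs_dirac_succ ?_
    have hnonneg (z : Chamber (N + 1)) := gibbs_nonneg hrate (L1.dirac_nonneg z)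
    have hmass := L1.hasSum_mass (L1.ofStochastic hnonneg ih (levelOp hrate N (L1.dirac z)))
    rw [L1.mass_ofStochastic, levelOp, L1.mass_ofStochastic, L1.mass_dirac] at hmass
    refine hmass.congr_fun fun x => ?_
    rw [L1.ofStochastic_gibbs_dirac_apply, gibbs, gibbs, L1.ofStochastic_dirac_apply]

/-- The operator that maps a density `m` on the top level to the Gibbs density `gibbs rate m`. -/
def gibbsOp (hrate : ∀ a, 0 < rate a) (N : ℕ) : L1 (Chamber (N + 1)) →L[ℝ] L1 (GT (N + 1)) :=
  L1.ofStochastic (fun z => gibbs_nonneg hrate (L1.dirac_nonneg z)) (hasSum_gibbs_dirac hrate N)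

theorem gibbsOp_apply (hrate : ∀ a, 0 < rate a) (m : L1 (Chamber (N + 1))) (x : GT (N + 1)) :
    gibbsOp hrate N m x = gibbs rate m x := L1.ofStochastic_gibbs_dirac_apply ..

theorem mass_gibbsOp (hrate : ∀ a, 0 < rate a) (m : L1 (Chamber (N + 1))) :
    L1.mass (gibbsOp hrate N m) = L1.mass m := L1.mass_ofStochastic ..

theorem map_dropTop_gibbsOp (hrate : ∀ a, 0 < rate a) (m : L1 (Chamber (N + 2))) :
    L1.map GT.dropTop (gibbsOp hrate (N + 1) m) = gibbsOp hrate N (levelOp hrate N m) := by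
  suffices h : (L1.map GT.dropTop).comp (gibbsOp hrate (N + 1)) =
      (gibbsOp hrate N).comp (levelOp hrate N) from DFunLike.congr_fun h m
  refine L1.clm_ext fun z => ?_
  ext x
  have hlevel : gibbsOp hrate N (levelOp hrate N (L1.dirac z)) x =
      gibbs rate (levelKernel rate z) x := by
    rw [gibbsOp_apply, gibbs, gibbs, levelOp, L1.ofStochastic_dirac_apply]
  rw [ContinuousLinearMap.comp_apply, ContinuousLinearMap.comp_apply, hlevel]
  by_cases hx : Interlaces x.top z
  · obtain ⟨y, rfl, rfl⟩ := GT.exists_dropTop_eq_top_eq hx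
    rw [L1.map_apply_of_forall_ne y fun y' hdrop hne => ?_, gibbsOp_apply, gibbs_succ,
      L1.dirac_self, one_mul]
    rw [gibbsOp_apply, gibbs_dirac_of_top_ne rate fun htop => hne (GT.ext_dropTop_top hdrop htop)]
  · rw [gibbs_eq_zero rate (levelKernel_of_not_interlaces rate hx)]
    refine L1.map_apply_eq_zero fun y hdrop => ?_
    rw [gibbsOp_apply, gibbs_dirac_of_top_ne]
    rintro rfl
    exact hx (hdrop ▸ y.interlaces_top_dropTop)

end Gibbs

/-! ### Intertwining with the push-block dynamics -/

section Intertwining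

variable {rate : ℕ → ℝ} {M : ℝ} {N : ℕ}

open Classical in
theorem gibbsOp_dirac_apply (hrate : ∀ a, 0 < rate a) (z : Chamber (N + 1)) (x : GT (N + 1)) :
    gibbsOp hrate N (L1.dirac z) x =
      if x.top = z then (harmonic rate (N + 1) z)⁻¹ * weight rate x else 0 := by
  rw [gibbsOp_apply, gibbs_eq_mul_weight fun n x => (harmonic_pos hrate n x).ne']
  split_ifs with h
  · rw [h, L1.dirac_self, one_div]
  · rw [L1.dirac_ne (Ne.symm h), zero_div, zero_mul]

open Classical in
theorem hasSum_weight (hrate : ∀ a, 0 < rate a) (z : Chamber (N + 1)) :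
    HasSum (fun x : GT (N + 1) => if x.top = z then weight rate x else 0)
      (harmonic rate (N + 1) z) := by
  have hmass := (L1.hasSum_mass (gibbsOp hrate N (L1.dirac z))).mul_left (harmonic rate (N + 1) z)
  rw [mass_gibbsOp, L1.mass_dirac, mul_one] at hmass
  refine hmass.congr_fun fun x => ?_
  rw [gibbsOp_dirac_apply, mul_ite, mul_inv_cancel_left₀ (harmonic_pos hrate _ _).ne', mul_zero]

open Classical in
theorem pushBlockDual_gibbsOp_dirac_apply (hrate : ∀ a, 0 < rate a) (hM : ∀ a, |rate a| ≤ M)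
    (z : Chamber (N + 1)) (x : GT (N + 1)) :
    pushBlockDual (N + 1) hM (gibbsOp hrate N (L1.dirac z)) x =
      (harmonic rate (N + 1) z)⁻¹ * ∑ i, rate (z.pos i) *
        ((if z.CanRaise i then if x.top = z.raise i then weight rate x else 0 else 0) -
          if x.top = z then weight rate x else 0) := by
  rw [pushBlockDual_apply_of_eq_weight (fun a => (hrate a).ne') hM (gibbsOp_dirac_apply hrate z),
    gibbsOp_dirac_apply, mul_assoc]
  have hout : (if x.top = z then (harmonic rate (N + 1) z)⁻¹ * weight rate x else 0) *
      ∑ i, rate (x.top.pos i) = (harmonic rate (N + 1) z)⁻¹ *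
        ∑ i, rate (z.pos i) * if x.top = z then weight rate x else 0 := by
    split_ifs with h
    · rw [h, ← Finset.sum_mul]
      ring
    · simp only [zero_mul, mul_zero, Finset.sum_const_zero]
  rw [hout, ← mul_sub, Finset.mul_sum, ← Finset.sum_sub_distrib]
  refine congrArg _ (Finset.sum_congr rfl fun i _ => ?_)
  rw [mul_sub, ite_and, if_congr (eq_comm (a := z.raise i)) rfl rfl]
  split_ifs <;> ring

/- The push-block dynamics conserves mass, and the mass of the image of the Gibbs density over `z`
is the killed generator applied to `𝔥` at `z`, up to the factor `1 / 𝔥 z`. -/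
theorem killedGenerator_harmonic (hrate : ∀ a, 0 < rate a) (hM : ∀ a, |rate a| ≤ M)
    (z : Chamber (N + 1)) : killedGenerator rate (harmonic rate (N + 1)) z = 0 := by
  classical
  have hflow : HasSum
      (fun x : GT (N + 1) => ∑ i, rate (z.pos i) *
        ((if z.CanRaise i then if x.top = z.raise i then weight rate x else 0 else 0) -
          if x.top = z then weight rate x else 0))
      (killedGenerator rate (harmonic rate (N + 1)) z) := by
    refine hasSum_sum fun i _ => HasSum.mul_left _ (HasSum.sub ?_ (hasSum_weight hrate z))
    split_ifs
    · exact hasSum_weight hrate _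
    · exact hasSum_zero
  have hmass := (L1.hasSum_mass (pushBlockDual (N + 1) hM (gibbsOp hrate N (L1.dirac z)))).unique
    ((hflow.mul_left _).congr_fun (pushBlockDual_gibbsOp_dirac_apply hrate hM z))
  rw [pushBlockDual, mass_jumpDual] at hmass
  exact (mul_eq_zero.1 hmass.symm).resolve_left (inv_ne_zero (harmonic_pos hrate N z).ne')

theorem doobRate_harmonic_nonneg (hrate : ∀ a, 0 < rate a) (i : Fin (N + 1))
    (x : Chamber (N + 1)) : 0 ≤ doobRate rate (harmonic rate (N + 1)) i x := by
  rw [doobRate]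
  split_ifs
  · exact mul_nonneg (hrate _).le
      (div_nonneg (harmonic_pos hrate _ _).le (harmonic_pos hrate _ _).le)
  · exact le_rfl

theorem doobRate_harmonic_le (hrate : ∀ a, 0 < rate a) (hM : ∀ a, |rate a| ≤ M) (i : Fin (N + 1))
    (x : Chamber (N + 1)) :
    doobRate rate (harmonic rate (N + 1)) i x ≤ ∑ _i : Fin (N + 1), M := calc
  _ ≤ ∑ j, doobRate rate (harmonic rate (N + 1)) j x :=
    Finset.single_le_sum (fun _ _ => doobRate_harmonic_nonneg hrate _ x) (Finset.mem_univ i)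
  _ = ∑ j, rate (x.pos j) :=
    sum_doobRate (harmonic_pos hrate N x).ne' (killedGenerator_harmonic hrate hM x)
  _ ≤ ∑ _j : Fin (N + 1), M := Finset.sum_le_sum fun _ _ => (le_abs_self _).trans (hM _)

theorem abs_doobRate_harmonic_le (hrate : ∀ a, 0 < rate a) (hM : ∀ a, |rate a| ≤ M)
    (i : Fin (N + 1)) (x : Chamber (N + 1)) :
    |doobRate rate (harmonic rate (N + 1)) i x| ≤ ∑ _i : Fin (N + 1), M :=
  (abs_of_nonneg (doobRate_harmonic_nonneg hrate i x)).trans_le (doobRate_harmonic_le hrate hM i x)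

/-- The generator of level `N + 1`, the Doob transform by `𝔥` of the killed pure-birth chains,
acting on densities. -/
def levelDual (hrate : ∀ a, 0 < rate a) (hM : ∀ a, |rate a| ≤ M) (N : ℕ) :
    L1 (Chamber (N + 1)) →L[ℝ] L1 (Chamber (N + 1)) :=
  jumpDual (doobRate rate (harmonic rate (N + 1))) (fun i x => x.raise i) _
    (abs_doobRate_harmonic_le hrate hM)

open Classical in
theorem levelDual_dirac_apply (hrate : ∀ a, 0 < rate a) (hM : ∀ a, |rate a| ≤ M)
    (z y : Chamber (N + 1)) :
    levelDual hrate hM N (L1.dirac z) y =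
      (harmonic rate (N + 1) z)⁻¹ * ∑ i, rate (z.pos i) *
        ((if z.CanRaise i then if y = z.raise i then harmonic rate (N + 1) y else 0 else 0) -
          if y = z then harmonic rate (N + 1) y else 0) := by
  have hz := (harmonic_pos hrate N z).ne'
  simp only [levelDual, jumpDual_dirac, L1.sum_apply, L1.smul_apply, L1.sub_apply, mul_sub,
    Finset.sum_sub_distrib]
  refine congrArg₂ _ ?_ ?_
  · rw [Finset.mul_sum]
    refine Finset.sum_congr rfl fun i _ => ?_
    rw [doobRate, L1.dirac_apply, if_congr (eq_comm (a := z.raise i)) rfl rfl]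
    split_ifs with hraise hy
    · rw [hy]
      field_simp
    all_goals ring
  · rw [← Finset.sum_mul, ← Finset.sum_mul, sum_doobRate hz (killedGenerator_harmonic hrate hM z),
      L1.dirac_apply, if_congr (eq_comm (a := z)) rfl rfl]
    split_ifs with hy
    · rw [hy]
      field_simp
    · ring

theorem gibbsOp_comp_levelDual (hrate : ∀ a, 0 < rate a) (hM : ∀ a, |rate a| ≤ M) (N : ℕ) :
    (gibbsOp hrate N).comp (levelDual hrate hM N) =
      (pushBlockDual (N + 1) hM).comp (gibbsOp hrate N) := by
  classical
  refine L1.clm_ext fun z => ?_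
  ext x
  rw [ContinuousLinearMap.comp_apply, ContinuousLinearMap.comp_apply,
    pushBlockDual_gibbsOp_dirac_apply, gibbsOp_apply,
    gibbs_eq_mul_weight fun n x => (harmonic_pos hrate n x).ne', levelDual_dirac_apply,
    div_mul_eq_mul_div, mul_assoc, mul_div_assoc, Finset.sum_mul, Finset.sum_div]
  refine congrArg _ (Finset.sum_congr rfl fun i _ => ?_)
  have htop := (harmonic_pos hrate N x.top).ne'
  split_ifs <;> field_simp <;> ring

theorem levelSemigroup_eq_expKernel (hrate : ∀ a, 0 < rate a) (hM : ∀ a, |rate a| ≤ M) (t : ℝ)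
    (x y : Chamber (N + 1)) :
    levelSemigroup rate t x y = expKernel (doobGenerator rate (harmonic rate (N + 1))) t x y :=
  (expKernel_doobGenerator hM (fun x => (harmonic_pos hrate N x).ne')
    (killedGenerator_harmonic hrate hM) t x y).symm

theorem isMarkovSemigroup_levelSemigroup (hrate : ∀ a, 0 < rate a) (hM : ∀ a, |rate a| ≤ M)
    (N : ℕ) : IsMarkovSemigroup fun t (x y : Chamber (N + 1)) => levelSemigroup rate t x y := by
  simp only [levelSemigroup_eq_expKernel hrate hM]
  exact isMarkovSemigroup_jumpGenerator (doobRate_harmonic_nonneg hrate)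
    (doobRate_harmonic_le hrate hM)

theorem exp_levelDual_dirac_apply (hrate : ∀ a, 0 < rate a) (hM : ∀ a, |rate a| ≤ M) (t : ℝ)
    (x y : Chamber (N + 1)) :
    NormedSpace.exp (t • levelDual hrate hM N) (L1.dirac x) y = levelSemigroup rate t x y := by
  rw [levelSemigroup_eq_expKernel hrate hM]
  exact (expKernel_jumpGenerator _ t x y).symm

theorem exp_pushBlockDual_dirac_apply (hM : ∀ a, |rate a| ≤ M) (t : ℝ) (x y : GT N) :
    NormedSpace.exp (t • pushBlockDual N hM) (L1.dirac x) y =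
      expKernel (pushBlockGenerator rate) t x y :=
  (expKernel_jumpGenerator _ t x y).symm

end Intertwining

/-! ### Autonomy of the lower levels -/

section Lumping

variable {N : ℕ}

/-- A particle of a pattern without top level, as a particle of the whole pattern. -/
def Particle.up (p : Particle N) : Particle (N + 1) := ⟨p.1.castSucc, p.2⟩

theorem Particle.up_injective : Function.Injective (Particle.up (N := N)) := fun _ _ h =>
  Particle.ext_val (congrArg (fun r : Particle (N + 1) => (r.1 : ℕ)) h)
    (congrArg (fun r : Particle (N + 1) => (r.2 : ℕ)) h)

theorem Particle.exists_up {q : Particle (N + 1)} (h : (q.1 : ℕ) < N) :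
    ∃ p : Particle N, p.up = q :=
  ⟨⟨⟨q.1, h⟩, q.2⟩, rfl⟩

theorem GT.dropTop_pos (x : GT (N + 1)) (p : Particle N) : x.dropTop.pos p = x.pos p.up := rfl

theorem blocked_up_iff (x : GT (N + 1)) (p : Particle N) :
    Blocked x p.up ↔ Blocked x.dropTop p := by
  constructor
  · rintro ⟨q, hq, hpos⟩
    have hlevel : (p.1 : ℕ) = q.1 + 1 := hq.1
    obtain ⟨q, rfl⟩ := Particle.exists_up (q := q) (by have := p.1.2; omega)
    exact ⟨q, hq, hpos⟩
  · rintro ⟨q, hq, hpos⟩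
    exact ⟨q.up, hq, hpos⟩

theorem Moves.up {x : GT (N + 1)} {p q : Particle N} (h : Moves x.dropTop p q) :
    Moves x p.up q.up := by
  induction h with
  | self => exact Moves.self
  | push r r' _ hn hb ih => exact Moves.push r.up r'.up ih hn hb

theorem Moves.of_up {x : GT (N + 1)} {p : Particle N} {r : Particle (N + 1)}
    (h : Moves x p.up r) {q : Particle N} (hq : q.up = r) : Moves x.dropTop p q := by
  induction h generalizing q with
  | self => exact Particle.up_injective hq ▸ Moves.self
  | push r r' _ hn hb ih =>
    subst hq
    have hlevel : (q.1 : ℕ) = r.1 + 1 := hn.1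
    obtain ⟨r, rfl⟩ := Particle.exists_up (q := r) (by have := q.1.2; omega)
    exact Moves.push r q (ih rfl) hn hb

theorem dropTop_jump_up (x : GT (N + 1)) {p : Particle N} (hp : ¬ Blocked x p.up)
    (hp' : ¬ Blocked x.dropTop p) : (jump x p.up hp).dropTop = jump x.dropTop p hp' := by
  refine GT.ext_pos fun q => ?_
  rw [GT.dropTop_pos]
  by_cases h : Moves x.dropTop p q
  · rw [GT.pos_jump_of_moves hp h.up, GT.pos_jump_of_moves hp' h, GT.dropTop_pos]
  · rw [GT.pos_jump_of_not_moves hp fun hup => h (hup.of_up rfl),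
      GT.pos_jump_of_not_moves hp' h, GT.dropTop_pos]

theorem dropTop_ring_up (x : GT (N + 1)) (p : Particle N) :
    (ring x p.up).dropTop = ring x.dropTop p := by
  rw [ring, ring]
  by_cases h : Blocked x p.up
  · rw [dif_pos h, dif_pos ((blocked_up_iff x p).1 h)]
  · have h' := mt (blocked_up_iff x p).2 h
    rw [dif_neg h, dif_neg h', dropTop_jump_up x h h']

theorem dropTop_ring_last (x : GT (N + 1)) (i : Fin ((Fin.last N : ℕ) + 1)) :
    (ring x ⟨Fin.last N, i⟩).dropTop = x.dropTop := by
  rw [ring]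
  split_ifs with h
  · rfl
  · refine GT.ext_pos fun q => GT.pos_jump_of_not_moves (q := q.up) h fun hmoves => ?_
    have hlevel : N ≤ (q.1 : ℕ) := hmoves.level_le
    have := q.1.2
    omega

theorem map_dropTop_comp_pushBlockDual {rate : ℕ → ℝ} {M : ℝ} (hM : ∀ a, |rate a| ≤ M) :
    (L1.map GT.dropTop).comp (pushBlockDual (N + 1) hM) =
      (pushBlockDual N hM).comp (L1.map GT.dropTop) := by
  refine L1.clm_ext fun x => ?_
  rw [ContinuousLinearMap.comp_apply, ContinuousLinearMap.comp_apply, L1.map_dirac, pushBlockDual,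
    pushBlockDual, jumpDual_dirac, jumpDual_dirac, map_sum]
  simp only [map_smul, map_sub, L1.map_dirac]
  rw [Fintype.sum_sigma, Fintype.sum_sigma, Fin.sum_univ_castSucc]
  simp only [dropTop_ring_last, sub_self, smul_zero, Finset.sum_const_zero, add_zero]
  refine Finset.sum_congr rfl fun k _ => Finset.sum_congr rfl fun i _ => ?_
  rw [← dropTop_ring_up]
  rfl

end Lumping

/-! ### Single levels of the push-block process -/

instance (n : ℕ) : Countable (Chamber n) :=
  Function.Injective.countable (f := Chamber.pos) fun _ _ h => Chamber.ext h

instance (N : ℕ) : Countable (GT N) :=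
  Function.Injective.countable (f := GT.level) fun _ _ h => GT.ext h

instance (n : ℕ) : DiscreteMeasurableSpace (Chamber n) := ⟨fun _ => trivial⟩

instance (N : ℕ) : DiscreteMeasurableSpace (GT N) := ⟨fun _ => trivial⟩

section SingleLevels

variable {rate : ℕ → ℝ} {M : ℝ} {N : ℕ}

theorem map_top_apply_of_eq_gibbs (hrate : ∀ a, 0 < rate a) {m : Chamber (N + 1) → ℝ}
    {ν : L1 (GT (N + 1))} (h : ∀ x, ν x = gibbs rate m x) (z : Chamber (N + 1)) :
    L1.map GT.top ν z = m z := by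
  rw [L1.map_apply]
  have hgibbs := (hasSum_gibbs_dirac hrate N z).mul_left (m z)
  rw [mul_one] at hgibbs
  refine (L1.hasSum_mass _).unique (hgibbs.congr_fun fun x => ?_)
  rw [L1.restr_apply]
  by_cases hx : x.top = z
  · subst hx
    have hmem : x ∈ GT.top ⁻¹' {x.top} := rfl
    rw [Set.indicator_of_mem hmem, h, gibbs_eq_mul_gibbs_dirac_top]
  · have hmem : x ∉ GT.top ⁻¹' {z} := hx
    rw [Set.indicator_of_notMem hmem, gibbs_dirac_of_top_ne rate hx, mul_zero]

theorem exists_eq_gibbsOp_of_eq_gibbs (hrate : ∀ a, 0 < rate a) {m : Chamber (N + 1) → ℝ}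
    {ν : L1 (GT (N + 1))} (h : ∀ x, ν x = gibbs rate m x) :
    ∃ m' : L1 (Chamber (N + 1)), ⇑m' = m ∧ ν = gibbsOp hrate N m' := by
  have hm := funext (map_top_apply_of_eq_gibbs hrate h)
  refine ⟨L1.map GT.top ν, hm, ?_⟩
  ext x
  rw [gibbsOp_apply, hm, h]

theorem exp_gibbsOp_comp_levelDual (hrate : ∀ a, 0 < rate a) (hM : ∀ a, |rate a| ≤ M) (t : ℝ) :
    (gibbsOp hrate N).comp (NormedSpace.exp (t • levelDual hrate hM N)) =
      (NormedSpace.exp (t • pushBlockDual (N + 1) hM)).comp (gibbsOp hrate N) :=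
  comp_exp_smul_of_comp_eq (gibbsOp_comp_levelDual hrate hM N) t

variable {Ω : Type*} [MeasurableSpace Ω] {μ : Measure Ω} [IsFiniteMeasure μ]
  {X : ℝ≥0 → Ω → GT (N + 1)} {m : L1 (Chamber (N + 1))}

theorem isMarkovProcess_top (hrate : ∀ a, 0 < rate a) (hM : ∀ a, |rate a| ≤ M)
    (hX : IsMarkovProcess μ X (expKernel (pushBlockGenerator rate)))
    (hm : L1.ofMeasure (μ.map (X 0)) = gibbsOp hrate N m) :
    IsMarkovProcess μ (fun t ω => (X t ω).top) fun t x y => levelSemigroup rate t x y :=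
  hX.comp_of_intertwining (exp_pushBlockDual_dirac_apply hM) (exp_levelDual_dirac_apply hrate hM)
    (exp_gibbsOp_comp_levelDual hrate hM)
    (fun z x hx => by rw [gibbsOp_apply, gibbs_dirac_of_top_ne rate hx])
    (fun z => by rw [mass_gibbsOp, L1.mass_dirac]) hm

theorem isMarkovProcess_dropTop (hM : ∀ a, |rate a| ≤ M)
    (hX : IsMarkovProcess μ X (expKernel (pushBlockGenerator rate))) :
    IsMarkovProcess μ (fun t ω => (X t ω).dropTop) (expKernel (pushBlockGenerator rate)) :=
  hX.comp_of_lumping (exp_pushBlockDual_dirac_apply hM) (exp_pushBlockDual_dirac_apply hM)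
    (comp_exp_smul_of_comp_eq (map_dropTop_comp_pushBlockDual hM))

theorem isMarkovProcess_level (hrate : ∀ a, 0 < rate a) (hM : ∀ a, |rate a| ≤ M)
    (hX : IsMarkovProcess μ X (expKernel (pushBlockGenerator rate)))
    (hm : L1.ofMeasure (μ.map (X 0)) = gibbsOp hrate N m) (k : Fin (N + 1)) :
    IsMarkovProcess μ (fun t ω => (X t ω).level k) fun t x y => levelSemigroup rate t x y := by
  induction N with
  | zero =>
    obtain rfl : k = Fin.last 0 := Subsingleton.elim (α := Fin 1) _ _
    exact isMarkovProcess_top hrate hM hX hm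
  | succ N ih =>
    induction k using Fin.lastCases with
    | last => exact isMarkovProcess_top hrate hM hX hm
    | cast k =>
      refine ih (isMarkovProcess_dropTop hM hX) (m := levelOp hrate N m) ?_ k
      rw [← map_dropTop_gibbsOp, ← hm, L1.map_ofMeasure]
      simp only [Measure.map_map .of_discrete (hX.measurable 0), Function.comp_def]

theorem measureReal_map_singleton_eq_gibbs (hrate : ∀ a, 0 < rate a) (hM : ∀ a, |rate a| ≤ M)
    (hX : IsMarkovProcess μ X (expKernel (pushBlockGenerator rate)))
    (hm : L1.ofMeasure (μ.map (X 0)) = gibbsOp hrate N m) (t : ℝ≥0) (x : GT (N + 1)) :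
    (μ.map (X t)).real {x} = gibbs rate (fun z => ∑' w, m w * levelSemigroup rate t w z) x := by
  rw [← L1.ofMeasure_apply, hX.ofMeasure_map_of_intertwining (exp_pushBlockDual_dirac_apply hM)
    (exp_gibbsOp_comp_levelDual hrate hM) hm, gibbsOp_apply]
  congr 1
  funext z
  simp only [← (L1.hasSum_apply_apply _ m z).tsum_eq, exp_levelDual_dirac_apply]

end SingleLevels

end PushBlock

open PushBlock in
theorem mainTheorem3_general {rate : ℕ → ℝ} (hrate : ∀ a, 0 < rate a)
    (hbdd : BddAbove (Set.range rate)) {N : ℕ} {m : Chamber (N + 1) → ℝ} {Ω : Type*}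
    [MeasurableSpace Ω] {μ : Measure Ω} [IsFiniteMeasure μ] {X : ℝ≥0 → Ω → GT (N + 1)}
    (hX : IsPushBlockProcess μ rate (gibbs rate m) X) :
    (∀ k : Fin (N + 1),
      IsMarkovSemigroup
        (fun t (x y : Chamber ((k : ℕ) + 1)) => levelSemigroup rate t x y) ∧
      IsMarkovProcess μ (fun t ω => (X t ω).level k) fun t x y => levelSemigroup rate t x y) ∧
    ∀ (T : ℝ≥0) (x : GT (N + 1)),
      (μ.map (X T)).real {x} =
        gibbs rate (fun z => ∑' w, m w * levelSemigroup rate (T : ℝ) w z) x := by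
  obtain ⟨M, hM⟩ := hbdd
  have habs (a : ℕ) : |rate a| ≤ M := (abs_of_pos (hrate a)).trans_le (hM ⟨a, rfl⟩)
  have hinit (x : GT (N + 1)) : L1.ofMeasure (μ.map (X 0)) x = gibbs rate m x :=
    (map_measureReal_apply (hX.markov.measurable 0) .of_discrete).trans (hX.initial x)
  obtain ⟨m, rfl, hm⟩ := exists_eq_gibbsOp_of_eq_gibbs hrate hinit
  exact ⟨fun k => ⟨isMarkovSemigroup_levelSemigroup hrate habs k,
    isMarkovProcess_level hrate habs hX.markov hm k⟩,
    measureReal_map_singleton_eq_gibbs hrate habs hX.markov hm⟩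

theorem mainTheorem3 (rate : ℕ → ℝ) (hrate : PushBlock.UB rate) (N : ℕ)
    (M : Measure (PushBlock.Chamber (N + 1))) [IsProbabilityMeasure M]
    {Ω : Type*} [MeasurableSpace Ω] (μ : Measure Ω) [IsProbabilityMeasure μ]
    (X : ℝ≥0 → Ω → PushBlock.GT (N + 1))
    (hX : PushBlock.IsPushBlockProcess μ rate
      (PushBlock.gibbs rate fun z => M.real {z}) X) :
    (∀ k : Fin (N + 1),
      PushBlock.IsMarkovSemigroup
        (fun t (x y : PushBlock.Chamber ((k : ℕ) + 1)) => PushBlock.levelSemigroup rate t x y) ∧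
      PushBlock.IsMarkovProcess μ (fun t ω => (X t ω).level k)
        (fun t x y => PushBlock.levelSemigroup rate t x y)) ∧
    ∀ (T : ℝ≥0) (x : PushBlock.GT (N + 1)),
      (μ.map (X T)).real {x} =
        PushBlock.gibbs rate
          (fun z => ∑' w, M.real {w} * PushBlock.levelSemigroup rate (T : ℝ) w z) x := by
  obtain ⟨s, C, hs, hsC⟩ := hrate
  exact mainTheorem3_general (fun a => hs.trans_le (hsC a).1)
    ⟨C, Set.forall_mem_range.2 fun a => (hsC a).2⟩ hX

end
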